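/- Let $\Sigma\subset\mathbf R^{n+1}$ be a smooth $n$-dimensional hypersurface without boundary (embedded or, more generally, immersed), with position vector $x$, smooth unit normal $\mathbf n$, second fundamental form $a_{ij}=\langle\nabla_{e_i}e_j,\mathbf n\rangle$, $|A|^2=\sum_{i,j}a_{ij}^2$ ($e_i$ a local orthonormal frame of $\Sigma$), and mean curvature $H=\operatorname{div}_\Sigma\mathbf n$. Suppose that $\Sigma$ is a self-shrinker, i.e. $H=\frac{\langle x,\mathbf n\rangle}{2}$, and let $$L=\Delta+|A|^2+\tfrac12-\tfrac12\langle x,\nabla(\cdot)\rangle ,$$ where $\nabla$ and $\Delta=\operatorname{div}_\Sigma\nabla$ are the gradient and the Laplacian of $\Sigma$. Then $H$ and, for each constant vector $v\in\mathbf R^{n+1}$, the function $\langle v,\mathbf n\rangle$ are smooth and satisfy $$LH=H\qquad\text{and}\qquad L\langle v,\mathbf n\rangle=\tfrac12\langle v,\mathbf n\rangle .$$ In particular $H$, respectively $\langle v,\mathbf n\rangle$, is an eigenfunction of $L$ with eigenvalue $-1$, respectively $-\frac12$, whenever it does not vanish identically (a function $u\not\equiv0$ is an eigenfunction with eigenvalue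 $\mu$ if $Lu=-\mu u$). Moreover, if $\Sigma$ is compact, then $L$ is self-adjoint in the weighted space: for all $u_1,u_2\in C^2(\Sigma)$, $$\int_\Sigma u_1\,(Lu_2)\,e^{-|x|^2/4}=\int_\Sigma (Lu_1)\,u_2\,e^{-|x|^2/4},$$ and, for all $u_1\in C^1(\Sigma)$ and $u_2\in C^2(\Sigma)$, both integrands below are integrable and $$-\int_\Sigma (u_1\,Lu_2)\,e^{-|x|^2/4}=\int_\Sigma\left(\langle\nabla u_1,\nabla u_2\rangle-|A|^2u_1u_2-\tfrac12u_1u_2\right)e^{-|x|^2/4}.$$ The integrals are with respect to the volume measure of $\Sigma$. -/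

import Mathlib

open MeasureTheory
open scoped Manifold ContDiff

noncomputable section

/-- Euclidean space of dimension `k`. -/
abbrev Euc (k : ℕ) : Type := EuclideanSpace ℝ (Fin k)

namespace Hypersurface

variable {n : ℕ} {M : Type*} [TopologicalSpace M] [ChartedSpace (Euc n) M]

/-- `X : M → ℝⁿ⁺¹` is a smooth immersion of the `n`-manifold `M` and `N` is a smooth unit normal
vector field along it; that is, `X` is an (immersed, possibly embedded) hypersurface
with unit normal `N`. -/
structure IsHypersurface [IsManifold (𝓡 n) ∞ M] (X N : M → Euc (n + 1)) : Prop where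
  smooth : ContMDiff (𝓡 n) 𝓘(ℝ, Euc (n + 1)) ∞ X
  immersion : ∀ p : M, Function.Injective (mfderiv (𝓡 n) 𝓘(ℝ, Euc (n + 1)) X p)
  smooth_normal : ContMDiff (𝓡 n) 𝓘(ℝ, Euc (n + 1)) ∞ N
  norm_normal : ∀ p : M, ‖N p‖ = 1
  normal : ∀ (p : M) (w : TangentSpace (𝓡 n) p),
    inner ℝ (E := Euc (n + 1)) (mfderiv (𝓡 n) 𝓘(ℝ, Euc (n + 1)) X p w) (N p) = 0

/-! Local coordinates. `e` is a chart of `M`, with coordinates `y₁, …, yₙ`. -/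

/-- The partial derivative `∂V/∂yᵢ` at `p`, in the chart `e`, of a function or of a vector field
`V` along `M`. -/
def partialD {F : Type*} [NormedAddCommGroup F] [NormedSpace ℝ F]
    (e : OpenPartialHomeomorph M (Euc n)) (V : M → F) (i : Fin n) (p : M) : F :=
  fderiv ℝ (V ∘ e.symm) (e p) (EuclideanSpace.single i 1)

/-- The induced metric `gᵢⱼ = ⟨∂ᵢX, ∂ⱼX⟩` at `p` in the chart `e`. -/
def metric (X : M → Euc (n + 1)) (e : OpenPartialHomeomorph M (Euc n)) (p : M) :
    Matrix (Fin n) (Fin n) ℝ :=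
  Matrix.of fun i j => inner ℝ (partialD e X i p) (partialD e X j p)

/-- The inverse metric `gⁱʲ` at `p` in the chart `e`. -/
def invMetric (X : M → Euc (n + 1)) (e : OpenPartialHomeomorph M (Euc n)) (p : M) :
    Matrix (Fin n) (Fin n) ℝ :=
  (metric X e p)⁻¹

/-- The second fundamental form `aᵢⱼ = ⟨∇_{∂ᵢ} ∂ⱼ, N⟩ = ⟨∂ᵢ∂ⱼX, N⟩` at `p` in the chart `e`. -/
def secondFundamentalForm (X N : M → Euc (n + 1)) (e : OpenPartialHomeomorph M (Euc n)) (p : M) :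
    Matrix (Fin n) (Fin n) ℝ :=
  Matrix.of fun i j =>
    inner ℝ
      (fderiv ℝ (fun y => fderiv ℝ (X ∘ e.symm) y (EuclideanSpace.single j 1)) (e p)
        (EuclideanSpace.single i 1))
      (N p)

/-! Geometric objects. Each of them is independent of the chart; at `p` it is computed in
the preferred chart at `p`. -/

/-- The tangential gradient `∇u = gⁱʲ (∂ᵢu) ∂ⱼX`, as a vector of `ℝⁿ⁺¹`. -/
def grad (X : M → Euc (n + 1)) (u : M → ℝ) (p : M) : Euc (n + 1) :=
  ∑ i, ∑ j, (invMetric X (chartAt (Euc n) p) p i j * partialD (chartAt (Euc n) p) u i p) •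
    partialD (chartAt (Euc n) p) X j p

/-- The divergence along the hypersurface, `div V = gⁱʲ ⟨∂ᵢV, ∂ⱼX⟩`
(which is `∑ₖ ⟨∇_{eₖ} V, eₖ⟩` for an orthonormal frame `eₖ`), of a vector field `V : M → ℝⁿ⁺¹`
along it, tangential or not. -/
def div (X V : M → Euc (n + 1)) (p : M) : ℝ :=
  ∑ i, ∑ j, invMetric X (chartAt (Euc n) p) p i j *
    inner ℝ (partialD (chartAt (Euc n) p) V i p) (partialD (chartAt (Euc n) p) X j p)

/-- The Laplacian of the hypersurface: `Δu = div ∇u`. -/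
def laplacian (X : M → Euc (n + 1)) (u : M → ℝ) (p : M) : ℝ :=
  div X (grad X u) p

/-- The mean curvature `H = div N`. -/
def meanCurvature (X N : M → Euc (n + 1)) (p : M) : ℝ :=
  div X N p

/-- The squared norm of the second fundamental form, `|A|² = gⁱᵏ gʲˡ aᵢⱼ aₖₗ`. -/
def normSqA (X N : M → Euc (n + 1)) (p : M) : ℝ :=
  ∑ i, ∑ j, ∑ k, ∑ l,
    invMetric X (chartAt (Euc n) p) p i k * invMetric X (chartAt (Euc n) p) p j l *
      secondFundamentalForm X N (chartAt (Euc n) p) p i j *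
      secondFundamentalForm X N (chartAt (Euc n) p) p k l

/-- The self-shrinker equation `H = ⟨x, n⟩ / 2`. -/
def IsSelfShrinker (X N : M → Euc (n + 1)) : Prop :=
  ∀ p : M, meanCurvature X N p = inner ℝ (X p) (N p) / 2

/-- The operator `L u = Δu + |A|² u + u / 2 - ⟨x, ∇u⟩ / 2`. -/
def opL (X N : M → Euc (n + 1)) (u : M → ℝ) (p : M) : ℝ :=
  laplacian X u p + normSqA X N p * u p + (1 / 2) * u p - (1 / 2) * inner ℝ (X p) (grad X u p)

/-- `u` is a smooth eigenfunction of `T` with eigenvalue `μ`: `T u = -μ u` and `u` is not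
identically zero. -/
def IsEigenfunction (T : (M → ℝ) → M → ℝ) (μ : ℝ) (u : M → ℝ) : Prop :=
  ContMDiff (𝓡 n) 𝓘(ℝ, ℝ) ∞ u ∧ (∀ p, T u p = -μ * u p) ∧ ∃ p, u p ≠ 0

/-- The volume measure of the domain of the chart `e`: `√(det g) dy`, carried to `M`. -/
def chartVolume [MeasurableSpace M] (X : M → Euc (n + 1))
    (e : OpenPartialHomeomorph M (Euc n)) : Measure M :=
  ((volume.restrict e.target).withDensity
    fun y => ENNReal.ofReal (Real.sqrt (metric X e (e.symm y)).det)).map e.symm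

/-- The volume measure of the hypersurface. By the change of variables formula, the measures
`chartVolume X e` agree on the overlaps of charts; their least upper bound is the measure on `M`
that restricts to `chartVolume X e` on the domain of every chart `e`. -/
def vol [MeasurableSpace M] (X : M → Euc (n + 1)) : Measure M :=
  ⨆ e ∈ atlas (Euc n) M, chartVolume X e

/-- The Gaussian weight `e^{-|x|²/4}`. -/
def gaussWeight (X : M → Euc (n + 1)) (p : M) : ℝ :=
  Real.exp (-‖X p‖ ^ 2 / 4)

end Hypersurface

end

noncomputable section

namespace Hypersurface

/-! ### Linear algebra of a frame and its dual frame -/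

section Frame

variable {ι : Type*} {E : Type*} [NormedAddCommGroup E] [InnerProductSpace ℝ E]

/-! Everything is computed in one chart, for a parametrization `F` with unit normal `ν`, coordinate
frame `∂ᵢF` and dual frame `θⁱ = gⁱʲ ∂ⱼF`. Invariance under changes of chart and a partition of
unity make the results global.

Eigenfunctions. Let `V` be a vector field along the hypersurface whose derivatives `∂ⱼV` are all
tangent. Then `∇⟨V, ν⟩ = ∑ ⟨V, ∂ⱼν⟩ θʲ`, which equals `∑ ⟨V, θᵏ⟩ ∂ₖν` because the shape operator is
self-adjoint. In the second form the Codazzi equation is just `∂ᵢ∂ₖν = ∂ₖ∂ᵢν`, and `paramDiv_shape`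
gives `Δ⟨V, ν⟩ = ∑ ⟨V, θᵏ⟩ ∂ₖH - |A|² ⟨V, ν⟩ + ∑ ⟨∂ᵢV, θᵏ⟩ ⟨∂ₖν, θⁱ⟩`. On a self-shrinker `∂ₖH = ⟨x,
∂ₖν⟩ / 2`, since `∂ₖx` is orthogonal to `ν`. The first sum is therefore `⟨x, ∇⟨V, ν⟩⟩ / 2` and
cancels the drift term of `L`. What remains (`paramL_inner_normal`) is `⟨V, ν⟩ / 2` plus the last
sum. For constant `V` the last sum vanishes. For `V = x / 2` one has `⟨V, ν⟩ = H` and the last sum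
is `H / 2`, so `LH = H`.

Integration by parts. By `sum_coordDeriv_eq_paramDiv`, `div V - ⟨x, V⟩ / 2` times `√(det g)
e^{-|x|²/4}` is a coordinate divergence when `V` is tangent. With `V = ∇u₂`, the sum of the two
integrands (`byPartsIntegrand`) becomes `∑ ∂ₖ(u₁ Qᵏ)` in a chart, and its integral vanishes when
`u₁` is supported there. A partition of unity applied to `u₁` gives the general case.
Self-adjointness follows because the resulting bilinear form is symmetric. -/

theorem eq_zero_of_mem_span_of_inner_eq_zero {t : ι → E} {w : E}
    (hw : w ∈ Submodule.span ℝ (Set.range t)) (h : ∀ i, inner ℝ w (t i) = 0) : w = 0 := by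
  have key : ∀ z ∈ Submodule.span ℝ (Set.range t), inner ℝ w z = 0 := by
    intro z hz
    induction hz using Submodule.span_induction with
    | mem x hx => obtain ⟨i, rfl⟩ := hx; exact h i
    | zero => simp
    | add x y _ _ hx hy => rw [inner_add_right, hx, hy, add_zero]
    | smul a x _ hx => rw [real_inner_smul_right, hx, mul_zero]
  exact inner_self_eq_zero.1 (key w hw)

/-- A vector orthogonal to a frame of a hyperplane and to its unit normal vanishes. -/
theorem eq_zero_of_inner_frame_eq_zero [Fintype ι] [FiniteDimensional ℝ E] {t : ι → E}
    (ht : LinearIndependent ℝ t)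
    (hdim : Module.finrank ℝ E = Fintype.card ι + 1) {ν : E} (hν : ‖ν‖ = 1)
    (htν : ∀ i, inner ℝ (t i) ν = 0) {w : E} (hw : ∀ i, inner ℝ w (t i) = 0)
    (hwν : inner ℝ w ν = 0) : w = 0 := by
  have hnot : ν ∉ Submodule.span ℝ (Set.range t) := fun hmem => by
    have := eq_zero_of_mem_span_of_inner_eq_zero hmem
      (fun i => by rw [real_inner_comm]; exact htν i)
    simp [this] at hν
  -- Adjoining `ν` to the frame gives as many independent vectors as the dimension, hence a spanning
  -- family.
  have hli : LinearIndependent ℝ (fun o : Option ι => o.casesOn' ν t) := ht.option hnot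
  have htop := hli.span_eq_top_of_card_eq_finrank' (by rw [Fintype.card_option, hdim])
  refine eq_zero_of_mem_span_of_inner_eq_zero (t := fun o : Option ι => o.casesOn' ν t)
    (by rw [htop]; trivial) ?_
  rintro (_ | i)
  · exact hwν
  · exact hw i

variable [Fintype ι] [DecidableEq ι]

/-- The frame `θⁱ = gⁱʲ tⱼ` dual to `t`, in the span of `t`. -/
def dualFrame (t : ι → E) (i : ι) : E :=
  ∑ j, (Matrix.gram ℝ t)⁻¹ i j • t j

theorem gram_inv_symm (t : ι → E) (i j : ι) :
    (Matrix.gram ℝ t)⁻¹ i j = (Matrix.gram ℝ t)⁻¹ j i := by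
  have h : ((Matrix.gram ℝ t)⁻¹).IsHermitian := (Matrix.isHermitian_gram ℝ t).inv
  simpa using (h.apply i j).symm

theorem isUnit_det_gram {t : ι → E} (ht : LinearIndependent ℝ t) :
    IsUnit (Matrix.gram ℝ t).det :=
  isUnit_iff_ne_zero.2 (Matrix.det_gram_ne_zero_iff_linearIndependent.2 ht)

theorem inner_dualFrame_frame {t : ι → E} (ht : LinearIndependent ℝ t) (i j : ι) :
    inner ℝ (dualFrame t i) (t j) = if i = j then 1 else 0 := by
  have h := congrFun (congrFun (Matrix.nonsing_inv_mul _ (isUnit_det_gram ht)) i) j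
  rw [Matrix.mul_apply, Matrix.one_apply] at h
  simpa [dualFrame, sum_inner, real_inner_smul_left] using h

theorem inner_frame_dualFrame {t : ι → E} (ht : LinearIndependent ℝ t) (i j : ι) :
    inner ℝ (t i) (dualFrame t j) = if i = j then 1 else 0 := by
  rw [real_inner_comm, inner_dualFrame_frame ht]
  simp [eq_comm]

theorem dualFrame_mem_span (t : ι → E) (i : ι) :
    dualFrame t i ∈ Submodule.span ℝ (Set.range t) :=
  Submodule.sum_mem _ fun j _ => Submodule.smul_mem _ _ (Submodule.subset_span ⟨j, rfl⟩)

/-- Behaviour of the dual frame under a change of frame. -/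
theorem dualFrame_change {t t' : ι → E} (ht : LinearIndependent ℝ t) (ht' : LinearIndependent ℝ t')
    {J : Matrix ι ι ℝ} (hJ : ∀ i, t i = ∑ k, J i k • t' k) {K : Matrix ι ι ℝ} (hK : K * J = 1)
    (k : ι) : dualFrame t' k = ∑ i, J i k • dualFrame t i := by
  have hspan : ∀ i, t i ∈ Submodule.span ℝ (Set.range t') := fun i => by
    rw [hJ i]
    exact Submodule.sum_mem _ fun j _ => Submodule.smul_mem _ _ (Submodule.subset_span ⟨j, rfl⟩)
  have ht'K : ∀ l, t' l = ∑ m, K l m • t m := fun l => by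
    have h1 : ∀ k, (K * J) l k • t' k = ∑ m, K l m • J m k • t' k := fun k => by
      simp [Matrix.mul_apply, Finset.sum_smul, mul_smul]
    calc t' l = ∑ k, (K * J) l k • t' k := by simp [hK, Matrix.one_apply]
      _ = ∑ m, K l m • t m := by
        simp only [h1, hJ, Finset.smul_sum]
        exact Finset.sum_comm
  rw [← sub_eq_zero]
  -- Both sides lie in the span of `t'`, so it suffices to pair them with each `t' l`; the
  -- right-hand side then yields an entry of `K * J = 1`.
  refine eq_zero_of_mem_span_of_inner_eq_zero (t := t') (Submodule.sub_mem _
    (dualFrame_mem_span t' k) (Submodule.sum_mem _ fun i _ => Submodule.smul_mem _ _ ?_)) ?_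
  · exact Submodule.sum_mem _ fun j _ => Submodule.smul_mem _ _ (hspan j)
  · intro l
    rw [inner_sub_left, inner_dualFrame_frame ht', sub_eq_zero]
    have h2 := congrFun (congrFun hK l) k
    rw [Matrix.mul_apply, Matrix.one_apply] at h2
    rw [ht'K l]
    simp only [sum_inner, inner_sum, real_inner_smul_left, real_inner_smul_right,
      inner_dualFrame_frame ht]
    simp only [mul_ite, mul_one, mul_zero, Finset.sum_ite_eq', Finset.mem_univ, if_true]
    rw [if_congr (eq_comm (a := k)) rfl rfl, ← h2]

variable [FiniteDimensional ℝ E]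

/-- Parseval's identity for a frame of a hyperplane, its dual frame and its unit normal. -/
theorem inner_eq_sum_frame {t : ι → E} (ht : LinearIndependent ℝ t)
    (hdim : Module.finrank ℝ E = Fintype.card ι + 1) {ν : E} (hν : ‖ν‖ = 1)
    (htν : ∀ i, inner ℝ (t i) ν = 0) (v w : E) :
    inner ℝ v w = ∑ i, inner ℝ v (dualFrame t i) * inner ℝ w (t i) +
      inner ℝ v ν * inner ℝ w ν := by
  -- The expansion of `v` in the basis formed by the frame and `ν`: the difference is orthogonal to
  -- every basis vector.
  have hv : v - (∑ i, inner ℝ v (dualFrame t i) • t i + inner ℝ v ν • ν) = 0 := by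
    have hdν : ∀ i, inner ℝ (dualFrame t i) ν = 0 := fun i => by
      simp [dualFrame, sum_inner, real_inner_smul_left, htν]
    have hv' : ∀ i, inner ℝ v (t i) =
        ∑ j, inner ℝ v (dualFrame t j) * inner ℝ (t j) (t i) := fun i => by
      have h := congrFun (congrFun (Matrix.mul_nonsing_inv _ (isUnit_det_gram ht)) i)
      simp only [Matrix.mul_apply, Matrix.one_apply] at h
      simp only [dualFrame, inner_sum, real_inner_smul_right, Finset.sum_mul]
      rw [Finset.sum_comm]
      have : ∀ k, ∑ j, (Matrix.gram ℝ t)⁻¹ j k * inner ℝ v (t k) * inner ℝ (t j) (t i) =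
          inner ℝ v (t k) * if i = k then 1 else 0 := fun k => by
        rw [← h k, Finset.mul_sum]
        refine Finset.sum_congr rfl fun j _ => ?_
        rw [Matrix.gram_apply, real_inner_comm (t i)]
        ring
      simp [this]
    refine eq_zero_of_inner_frame_eq_zero ht hdim hν htν (fun i => ?_) ?_
    · rw [inner_sub_left, inner_add_left, sum_inner, real_inner_smul_left, real_inner_comm (t i) ν,
        htν, hv']
      simp [real_inner_smul_left]
    · rw [inner_sub_left, inner_add_left, sum_inner, real_inner_smul_left,
        real_inner_self_eq_norm_sq, hν]
      simp [real_inner_smul_left, htν]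
  conv_lhs => rw [sub_eq_zero.1 hv]
  simp only [inner_add_left, sum_inner, real_inner_smul_left]
  simp only [real_inner_comm]

/-- The shape operator is self-adjoint. -/
theorem sum_inner_smul_dualFrame {t : ι → E} (ht : LinearIndependent ℝ t)
    (hdim : Module.finrank ℝ E = Fintype.card ι + 1) {ν : E} (hν : ‖ν‖ = 1)
    (htν : ∀ i, inner ℝ (t i) ν = 0) {b : ι → E} (hbν : ∀ i, inner ℝ (b i) ν = 0)
    (hb : ∀ i j, inner ℝ (b i) (t j) = inner ℝ (b j) (t i)) (v : E) :
    ∑ j, inner ℝ v (b j) • dualFrame t j = ∑ k, inner ℝ v (dualFrame t k) • b k := by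
  refine ext_inner_left ℝ fun w => ?_
  simp only [inner_sum, real_inner_smul_right]
  have h : ∀ v j, inner ℝ v (b j) = ∑ i, inner ℝ v (dualFrame t i) * inner ℝ (b j) (t i) :=
    fun v j => by rw [inner_eq_sum_frame ht hdim hν htν v (b j), hbν, mul_zero, add_zero]
  simp only [h v, h w, Finset.sum_mul, Finset.mul_sum]
  rw [Finset.sum_comm]
  refine Finset.sum_congr rfl fun i _ => Finset.sum_congr rfl fun j _ => ?_
  rw [hb j i]
  ring

end Frame

/-! ### Partial derivatives in `ℝⁿ` -/

section CoordDeriv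

variable {n : ℕ} {G : Type*} [NormedAddCommGroup G] [NormedSpace ℝ G]

/-- The partial derivative `∂f/∂yᵢ`. -/
def coordDeriv (i : Fin n) (f : Euc n → G) (y : Euc n) : G :=
  fderiv ℝ f y (EuclideanSpace.single i 1)

theorem contDiffAt_coordDeriv {m k : WithTop ℕ∞} {f : Euc n → G} {y : Euc n}
    (hf : ContDiffAt ℝ k f y) (hmk : m + 1 ≤ k) (i : Fin n) :
    ContDiffAt ℝ m (coordDeriv i f) y :=
  (hf.fderiv_right hmk).clm_apply contDiffAt_const

theorem coordDeriv_congr {f g : Euc n → G} {y : Euc n} (h : f =ᶠ[nhds y] g) (i : Fin n) :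
    coordDeriv i f y = coordDeriv i g y := by
  rw [coordDeriv, coordDeriv, h.fderiv_eq]

theorem coordDeriv_comm {f : Euc n → G} {y : Euc n} (hf : ContDiffAt ℝ 2 f y) (i j : Fin n) :
    coordDeriv i (coordDeriv j f) y = coordDeriv j (coordDeriv i f) y := by
  have hd : DifferentiableAt ℝ (fderiv ℝ f) y :=
    (hf.fderiv_right (m := 1) (by norm_num)).differentiableAt (by norm_num)
  have h : ∀ i j : Fin n, coordDeriv i (coordDeriv j f) y =
      fderiv ℝ (fderiv ℝ f) y (EuclideanSpace.single i 1) (EuclideanSpace.single j 1) := by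
    intro i j
    unfold coordDeriv
    rw [fderiv_clm_apply hd (differentiableAt_const _)]
    simp
  rw [h, h]
  exact hf.isSymmSndFDerivAt (by simp) _ _

theorem coordDeriv_sum {ι : Type*} [Fintype ι] {f : ι → Euc n → G} {y : Euc n}
    (hf : ∀ k, DifferentiableAt ℝ (f k) y) (i : Fin n) :
    coordDeriv i (fun z => ∑ k, f k z) y = ∑ k, coordDeriv i (f k) y := by
  unfold coordDeriv
  rw [fderiv_fun_sum fun k _ => hf k]
  simp

theorem coordDeriv_smul {c : Euc n → ℝ} {f : Euc n → G} {y : Euc n}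
    (hc : DifferentiableAt ℝ c y) (hf : DifferentiableAt ℝ f y) (i : Fin n) :
    coordDeriv i (fun z => c z • f z) y = c y • coordDeriv i f y + coordDeriv i c y • f y := by
  unfold coordDeriv
  rw [fderiv_fun_smul hc hf]
  simp

theorem coordDeriv_mul {c f : Euc n → ℝ} {y : Euc n}
    (hc : DifferentiableAt ℝ c y) (hf : DifferentiableAt ℝ f y) (i : Fin n) :
    coordDeriv i (fun z => c z * f z) y = c y * coordDeriv i f y + coordDeriv i c y * f y :=
  coordDeriv_smul hc hf i

theorem coordDeriv_inner {E : Type*} [NormedAddCommGroup E] [InnerProductSpace ℝ E]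
    {f g : Euc n → E} {y : Euc n}
    (hf : DifferentiableAt ℝ f y) (hg : DifferentiableAt ℝ g y) (i : Fin n) :
    coordDeriv i (fun z => inner ℝ (f z) (g z)) y =
      inner ℝ (f y) (coordDeriv i g y) + inner ℝ (coordDeriv i f y) (g y) :=
  fderiv_inner_apply ℝ hf hg _

theorem coordDeriv_const (c : G) (i : Fin n) (y : Euc n) : coordDeriv i (fun _ => c) y = 0 := by
  simp [coordDeriv]

/-- Product rule for a constant inner product. Applied to `⟨ν, ν⟩ = 1`, `⟨ν, ∂ⱼF⟩ = 0`, `⟨ν, θᵏ⟩ =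
0` and `⟨∂ⱼF, θᵏ⟩ = δⱼₖ`, it yields the structure equations of the hypersurface. -/
theorem inner_coordDeriv_of_const {E : Type*} [NormedAddCommGroup E] [InnerProductSpace ℝ E]
    {f g : Euc n → E} {y : Euc n} {c : ℝ}
    (hf : DifferentiableAt ℝ f y) (hg : DifferentiableAt ℝ g y)
    (h : ∀ᶠ z in nhds y, inner ℝ (f z) (g z) = c) (i : Fin n) :
    inner ℝ (f y) (coordDeriv i g y) = -inner ℝ (coordDeriv i f y) (g y) := by
  have h1 := coordDeriv_congr (g := fun _ => c) h i
  rw [coordDeriv_inner hf hg, coordDeriv_const] at h1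
  linarith

end CoordDeriv

/-! ### Smoothness of determinants and dual frames -/

section Det

theorem contDiffAt_gram {ι V E : Type*} [NormedAddCommGroup V] [NormedSpace ℝ V]
    [NormedAddCommGroup E] [InnerProductSpace ℝ E] {m : WithTop ℕ∞} {t : V → ι → E} {y : V}
    (ht : ∀ i, ContDiffAt ℝ m (fun z => t z i) y) (i j : ι) :
    ContDiffAt ℝ m (fun z => Matrix.gram ℝ (t z) i j) y := by
  simpa only [Matrix.gram_apply] using (ht i).inner ℝ (ht j)

variable {ι : Type*} [Fintype ι] [DecidableEq ι]
  {V : Type*} [NormedAddCommGroup V] [NormedSpace ℝ V]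

theorem contDiffAt_det {m : WithTop ℕ∞} {A : V → Matrix ι ι ℝ} {y : V}
    (hA : ∀ i j, ContDiffAt ℝ m (fun z => A z i j) y) :
    ContDiffAt ℝ m (fun z => (A z).det) y := by
  simp only [Matrix.det_apply]
  exact ContDiffAt.sum fun σ _ => (contDiffAt_prod fun i _ => hA _ _).const_smul _

theorem contDiffAt_inv {m : WithTop ℕ∞} {A : V → Matrix ι ι ℝ} {y : V}
    (hA : ∀ i j, ContDiffAt ℝ m (fun z => A z i j) y) (hdet : (A y).det ≠ 0) (i j : ι) :
    ContDiffAt ℝ m (fun z => (A z)⁻¹ i j) y := by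
  -- Cramer's rule: the entries of the inverse are determinants divided by `det A`, so smoothness of
  -- determinants suffices.
  simp only [Matrix.inv_def, Ring.inverse_eq_inv', Matrix.smul_apply, smul_eq_mul,
    Matrix.adjugate_apply]
  refine ((contDiffAt_det hA).inv hdet).mul (contDiffAt_det fun k l => ?_)
  by_cases hk : k = j
  · subst hk
    simpa using contDiffAt_const
  · simpa [Matrix.updateRow_ne hk] using hA k l

variable {E : Type*} [NormedAddCommGroup E] [InnerProductSpace ℝ E]

theorem contDiffAt_dualFrame {m : WithTop ℕ∞} {t : V → ι → E} {y : V}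
    (ht : ∀ i, ContDiffAt ℝ m (fun z => t z i) y) (hli : LinearIndependent ℝ (t y)) (i : ι) :
    ContDiffAt ℝ m (fun z => dualFrame (t z) i) y :=
  ContDiffAt.sum fun j _ =>
    (contDiffAt_inv (contDiffAt_gram ht) (isUnit_det_gram hli).ne_zero i j).smul (ht j)

/-- The determinant as a continuous multilinear function of the rows. -/
def detContinuousMultilinear (ι : Type*) [Fintype ι] [DecidableEq ι] :
    ContinuousMultilinearMap ℝ (fun _ : ι => ι → ℝ) ℝ where
  toMultilinearMap := (Matrix.detRowAlternating (R := ℝ) (n := ι)).toMultilinearMap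
  cont := Continuous.matrix_det continuous_id

/-- Jacobi's formula for the derivative of a determinant. -/
theorem fderiv_det_apply {A : V → Matrix ι ι ℝ} {y : V}
    (hA : ∀ i j, DifferentiableAt ℝ (fun z => A z i j) y) (hdet : (A y).det ≠ 0) (v : V) :
    fderiv ℝ (fun z => (A z).det) y v =
      (A y).det * ∑ i, ∑ j, (A y)⁻¹ j i * fderiv ℝ (fun z => A z i j) y v := by
  have hrow : ∀ i, HasFDerivAt (fun z => A z i)
      (ContinuousLinearMap.pi fun j => fderiv ℝ (fun z => A z i j) y) y := fun i =>
    hasFDerivAt_pi.2 fun j => (hA i j).hasFDerivAt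
  have h := HasFDerivAt.multilinear_comp (detContinuousMultilinear ι) hrow
  have h' : fderiv ℝ (fun z => (A z).det) y = _ := h.fderiv
  rw [h', sum_apply, Finset.mul_sum]
  refine Finset.sum_congr rfl fun i _ => ?_
  -- The derivative of a multilinear map is a sum over the rows, each replaced in turn by its
  -- derivative; Cramer's rule turns such a determinant into a row of the adjugate.
  change (Matrix.updateRow (A y) i fun j => fderiv ℝ (fun z => A z i j) y v).det = _
  rw [← Matrix.cramer_transpose_apply, Matrix.cramer_eq_adjugate_mulVec, ← Matrix.adjugate_transpose,
    Matrix.inv_def, Ring.inverse_eq_inv', Matrix.mulVec, dotProduct, Finset.mul_sum]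
  refine Finset.sum_congr rfl fun j _ => ?_
  simp only [Matrix.transpose_apply, Matrix.smul_apply, smul_eq_mul]
  field_simp

end Det

/-! ### Parametrized hypersurfaces -/

section Param

variable {n : ℕ}

/-- The coordinate frame of a parametrization. -/
def coordFrame {E : Type*} [NormedAddCommGroup E] [InnerProductSpace ℝ E]
    (F : Euc n → E) (y : Euc n) (i : Fin n) : E :=
  coordDeriv i F y

/-- The frame dual to the coordinate frame. -/
def coordDualFrame {E : Type*} [NormedAddCommGroup E] [InnerProductSpace ℝ E]
    (F : Euc n → E) (i : Fin n) (y : Euc n) : E :=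
  dualFrame (coordFrame F y) i

/-- `F` is a smooth parametrization of a piece of hypersurface, over `U`,
and `ν` is a smooth unit normal along it. -/
structure IsParam (F ν : Euc n → Euc (n + 1)) (U : Set (Euc n)) : Prop where
  isOpen : IsOpen U
  contDiffOn : ContDiffOn ℝ ∞ F U
  contDiffOn_normal : ContDiffOn ℝ ∞ ν U
  linearIndependent : ∀ y ∈ U, LinearIndependent ℝ (coordFrame F y)
  norm_normal : ∀ y ∈ U, ‖ν y‖ = 1
  inner_normal : ∀ y ∈ U, ∀ i, inner ℝ (coordDeriv i F y) (ν y) = 0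

/-- The mean curvature of a parametrized hypersurface. -/
def paramMeanCurvature (F ν : Euc n → Euc (n + 1)) (y : Euc n) : ℝ :=
  ∑ i, inner ℝ (coordDeriv i ν y) (coordDualFrame F i y)

/-- The squared norm of the second fundamental form of a parametrized hypersurface. -/
def paramNormSqA (F ν : Euc n → Euc (n + 1)) (y : Euc n) : ℝ :=
  ∑ i, ∑ k, inner ℝ (coordDeriv i ν y) (coordDualFrame F k y) *
    inner ℝ (coordDeriv k ν y) (coordDualFrame F i y)

/-- The tangential gradient of a function on a parametrized hypersurface. -/
def paramGrad (F : Euc n → Euc (n + 1)) (f : Euc n → ℝ) (y : Euc n) : Euc (n + 1) :=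
  ∑ i, coordDeriv i f y • coordDualFrame F i y

/-- The divergence along a parametrized hypersurface. -/
def paramDiv (F V : Euc n → Euc (n + 1)) (y : Euc n) : ℝ :=
  ∑ i, inner ℝ (coordDeriv i V y) (coordDualFrame F i y)

namespace IsParam

variable {F ν : Euc n → Euc (n + 1)} {U : Set (Euc n)} (h : IsParam F ν U) {y : Euc n} (hy : y ∈ U)
include h hy

theorem mem_nhds : U ∈ nhds y := h.isOpen.mem_nhds hy

theorem contDiffAt : ContDiffAt ℝ ∞ F y := h.contDiffOn.contDiffAt (h.mem_nhds hy)

theorem contDiffAt_normal : ContDiffAt ℝ ∞ ν y := h.contDiffOn_normal.contDiffAt (h.mem_nhds hy)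

theorem contDiffAt_coordFrame (i : Fin n) : ContDiffAt ℝ ∞ (coordDeriv i F) y :=
  contDiffAt_coordDeriv (h.contDiffAt hy) (by simp) i

theorem contDiffAt_coordDeriv_normal (i : Fin n) : ContDiffAt ℝ ∞ (coordDeriv i ν) y :=
  contDiffAt_coordDeriv (h.contDiffAt_normal hy) (by simp) i

theorem contDiffAt_coordDualFrame (i : Fin n) : ContDiffAt ℝ ∞ (coordDualFrame F i) y :=
  contDiffAt_dualFrame (t := coordFrame F) (h.contDiffAt_coordFrame hy) (h.linearIndependent y hy) i

theorem inner_coordDeriv_normal_normal (i : Fin n) : inner ℝ (coordDeriv i ν y) (ν y) = 0 := by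
  have hd := (h.contDiffAt_normal hy).differentiableAt (by simp)
  have := inner_coordDeriv_of_const (c := 1) hd hd (by
    filter_upwards [h.mem_nhds hy] with z hz
    rw [real_inner_self_eq_norm_sq, h.norm_normal z hz, one_pow]) i
  rw [real_inner_comm] at this
  linarith

theorem inner_coordDeriv_normal_frame (i j : Fin n) :
    inner ℝ (coordDeriv i ν y) (coordDeriv j F y) =
      -inner ℝ (ν y) (coordDeriv i (coordDeriv j F) y) := by
  have := inner_coordDeriv_of_const (c := 0)
    ((h.contDiffAt_normal hy).differentiableAt (by simp))
    ((h.contDiffAt_coordFrame hy j).differentiableAt (by simp)) (by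
      filter_upwards [h.mem_nhds hy] with z hz
      rw [real_inner_comm, h.inner_normal z hz]) i
  linarith

theorem inner_coordDeriv_normal_frame_comm (i j : Fin n) :
    inner ℝ (coordDeriv i ν y) (coordDeriv j F y) =
      inner ℝ (coordDeriv j ν y) (coordDeriv i F y) := by
  rw [h.inner_coordDeriv_normal_frame hy, h.inner_coordDeriv_normal_frame hy,
    coordDeriv_comm ((h.contDiffAt hy).of_le (ENat.LEInfty.out))]

theorem inner_normal_dualFrame (k : Fin n) : inner ℝ (ν y) (coordDualFrame F k y) = 0 := by
  simp only [coordDualFrame, dualFrame, inner_sum, real_inner_smul_right, coordFrame]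
  exact Finset.sum_eq_zero fun j _ => by rw [real_inner_comm, h.inner_normal y hy, mul_zero]

/-- Normal part of `∂ᵢθᵏ`; it is the source of the `|A|²` term in `paramDiv_shape`. -/
theorem inner_normal_coordDeriv_dualFrame (i k : Fin n) :
    inner ℝ (ν y) (coordDeriv i (coordDualFrame F k) y) =
      -inner ℝ (coordDeriv i ν y) (coordDualFrame F k y) :=
  inner_coordDeriv_of_const (c := 0)
    ((h.contDiffAt_normal hy).differentiableAt (by simp))
    ((h.contDiffAt_coordDualFrame hy k).differentiableAt (by simp)) (by
      filter_upwards [h.mem_nhds hy] with z hz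
      exact h.inner_normal_dualFrame hz k) i

/-- Tangential part of `∂ᵢθᵏ`: the numbers `⟨∂ᵢ∂ⱼF, θᵏ⟩` are the Christoffel symbols `Γᵏᵢⱼ`. -/
theorem inner_frame_coordDeriv_dualFrame (i j k : Fin n) :
    inner ℝ (coordDeriv j F y) (coordDeriv i (coordDualFrame F k) y) =
      -inner ℝ (coordDeriv i (coordDeriv j F) y) (coordDualFrame F k y) :=
  inner_coordDeriv_of_const (c := if j = k then 1 else 0)
    ((h.contDiffAt_coordFrame hy j).differentiableAt (by simp))
    ((h.contDiffAt_coordDualFrame hy k).differentiableAt (by simp)) (by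
      filter_upwards [h.mem_nhds hy] with z hz
      exact inner_frame_dualFrame (h.linearIndependent z hz) j k) i

theorem inner_eq_sum (v w : Euc (n + 1)) :
    inner ℝ v w = ∑ i, inner ℝ v (coordDualFrame F i y) * inner ℝ w (coordDeriv i F y) +
      inner ℝ v (ν y) * inner ℝ w (ν y) :=
  inner_eq_sum_frame (h.linearIndependent y hy) (by simp) (h.norm_normal y hy)
    (h.inner_normal y hy) v w

theorem sum_inner_smul_coordDualFrame (v : Euc (n + 1)) :
    ∑ j, inner ℝ v (coordDeriv j ν y) • coordDualFrame F j y =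
      ∑ k, inner ℝ v (coordDualFrame F k y) • coordDeriv k ν y :=
  sum_inner_smul_dualFrame (h.linearIndependent y hy) (by simp) (h.norm_normal y hy)
    (h.inner_normal y hy) (h.inner_coordDeriv_normal_normal hy)
    (h.inner_coordDeriv_normal_frame_comm hy) v

theorem coordDeriv_paramMeanCurvature (k : Fin n) :
    coordDeriv k (paramMeanCurvature F ν) y =
      ∑ i, inner ℝ (coordDeriv k (coordDeriv i ν) y) (coordDualFrame F i y) +
      ∑ i, inner ℝ (coordDeriv i ν y) (coordDeriv k (coordDualFrame F i) y) := by
  have hd := fun i => (h.contDiffAt_coordDeriv_normal hy i).differentiableAt (by simp)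
  have hθ := fun i => (h.contDiffAt_coordDualFrame hy i).differentiableAt (by simp)
  unfold paramMeanCurvature
  rw [coordDeriv_sum fun i => (hd i).inner ℝ (hθ i), ← Finset.sum_add_distrib]
  refine Finset.sum_congr rfl fun i _ => ?_
  rw [coordDeriv_inner (hd i) (hθ i), add_comm]

/-- The divergence of the image of a vector field under the shape operator. -/
theorem paramDiv_shape {V : Euc n → Euc (n + 1)} (hV : DifferentiableAt ℝ V y) :
    paramDiv F (fun z => ∑ k, inner ℝ (V z) (coordDualFrame F k z) • coordDeriv k ν z) y =
      ∑ k, inner ℝ (V y) (coordDualFrame F k y) * coordDeriv k (paramMeanCurvature F ν) y -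
      paramNormSqA F ν y * inner ℝ (V y) (ν y) +
      ∑ i, ∑ k, inner ℝ (coordDeriv i V y) (coordDualFrame F k y) *
        inner ℝ (coordDeriv k ν y) (coordDualFrame F i y) := by
  have hd := fun i => (h.contDiffAt_coordDeriv_normal hy i).differentiableAt (by simp)
  have hθ := fun i => (h.contDiffAt_coordDualFrame hy i).differentiableAt (by simp)
  have hder : ∀ i, coordDeriv i
      (fun z => ∑ k, inner ℝ (V z) (coordDualFrame F k z) • coordDeriv k ν z) y =
      ∑ k, (inner ℝ (V y) (coordDualFrame F k y) • coordDeriv i (coordDeriv k ν) y +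
        (inner ℝ (V y) (coordDeriv i (coordDualFrame F k) y) +
          inner ℝ (coordDeriv i V y) (coordDualFrame F k y)) • coordDeriv k ν y) := fun i => by
    have hs : ∀ k, DifferentiableAt ℝ
        (fun z => inner ℝ (V z) (coordDualFrame F k z) • coordDeriv k ν z) y := fun k =>
      (hV.inner ℝ (hθ k)).smul (hd k)
    rw [coordDeriv_sum hs]
    refine Finset.sum_congr rfl fun k _ => ?_
    rw [coordDeriv_smul (hV.inner ℝ (hθ k)) (hd k), coordDeriv_inner hV (hθ k)]
  -- This commutation plays the role of the Codazzi equation.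
  have hcomm : ∀ i k, coordDeriv i (coordDeriv k ν) y = coordDeriv k (coordDeriv i ν) y :=
    coordDeriv_comm ((h.contDiffAt_normal hy).of_le (ENat.LEInfty.out))
  have hcommF : ∀ i k, coordDeriv i (coordDeriv k F) y = coordDeriv k (coordDeriv i F) y :=
    coordDeriv_comm ((h.contDiffAt hy).of_le (ENat.LEInfty.out))
  have e1 : ∀ i k, inner ℝ (V y) (coordDeriv i (coordDualFrame F k) y) =
      -∑ j, inner ℝ (V y) (coordDualFrame F j y) *
        inner ℝ (coordDeriv i (coordDeriv j F) y) (coordDualFrame F k y) -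
      inner ℝ (V y) (ν y) * inner ℝ (coordDeriv i ν y) (coordDualFrame F k y) := fun i k => by
    rw [h.inner_eq_sum hy (V y), real_inner_comm (ν y) (coordDeriv i (coordDualFrame F k) y),
      h.inner_normal_coordDeriv_dualFrame hy, mul_neg, ← sub_eq_add_neg, ← Finset.sum_neg_distrib]
    congr 1
    refine Finset.sum_congr rfl fun j _ => ?_
    rw [real_inner_comm (coordDeriv j F y), h.inner_frame_coordDeriv_dualFrame hy, mul_neg]
  have e2 : ∀ i k, inner ℝ (coordDeriv i ν y) (coordDeriv k (coordDualFrame F i) y) =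
      -∑ j, inner ℝ (coordDeriv i ν y) (coordDualFrame F j y) *
        inner ℝ (coordDeriv k (coordDeriv j F) y) (coordDualFrame F i y) := fun i k => by
    rw [h.inner_eq_sum hy (coordDeriv i ν y), h.inner_coordDeriv_normal_normal hy, zero_mul,
      add_zero, ← Finset.sum_neg_distrib]
    refine Finset.sum_congr rfl fun j _ => ?_
    rw [real_inner_comm (coordDeriv j F y), h.inner_frame_coordDeriv_dualFrame hy, mul_neg]
  -- The Christoffel terms coming from the coefficients `⟨V, θᵏ⟩` match those coming from the dual
  -- frame inside `∂ₖH`, after renaming indices and using the symmetry of the second derivatives of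
  -- `F`.
  have e3 : ∑ i, ∑ k, (∑ j, inner ℝ (V y) (coordDualFrame F j y) *
        inner ℝ (coordDeriv i (coordDeriv j F) y) (coordDualFrame F k y)) *
          inner ℝ (coordDeriv k ν y) (coordDualFrame F i y) =
      ∑ k, inner ℝ (V y) (coordDualFrame F k y) *
        ∑ i, ∑ j, inner ℝ (coordDeriv i ν y) (coordDualFrame F j y) *
          inner ℝ (coordDeriv k (coordDeriv j F) y) (coordDualFrame F i y) := by
    simp only [Finset.sum_mul, Finset.mul_sum]
    rw [Finset.sum_comm_cycle]
    refine Finset.sum_congr rfl fun j _ => ?_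
    rw [Finset.sum_comm]
    refine Finset.sum_congr rfl fun i _ => Finset.sum_congr rfl fun k _ => ?_
    rw [hcommF k j]
    ring
  have e4 : ∑ k, inner ℝ (V y) (coordDualFrame F k y) * coordDeriv k (paramMeanCurvature F ν) y =
      ∑ i, ∑ k, inner ℝ (V y) (coordDualFrame F k y) *
        inner ℝ (coordDeriv i (coordDeriv k ν) y) (coordDualFrame F i y) -
      ∑ i, ∑ k, (∑ j, inner ℝ (V y) (coordDualFrame F j y) *
        inner ℝ (coordDeriv i (coordDeriv j F) y) (coordDualFrame F k y)) *
          inner ℝ (coordDeriv k ν y) (coordDualFrame F i y) := by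
    rw [e3, Finset.sum_comm, ← Finset.sum_sub_distrib]
    refine Finset.sum_congr rfl fun k _ => ?_
    rw [h.coordDeriv_paramMeanCurvature hy, mul_add, sub_eq_add_neg, ← mul_neg]
    simp only [e2, Finset.sum_neg_distrib, Finset.mul_sum, hcomm k]
  unfold paramDiv
  simp only [hder, sum_inner, inner_add_left, real_inner_smul_left]
  rw [e4, paramNormSqA]
  simp only [e1, Finset.sum_mul, ← Finset.sum_sub_distrib, ← Finset.sum_add_distrib]
  refine Finset.sum_congr rfl fun i _ => Finset.sum_congr rfl fun k _ => ?_
  rw [← Finset.sum_mul]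
  ring

end IsParam

end Param

/-! ### The operator `L` on a parametrized self-shrinker -/

section Param

variable {n : ℕ}

/-- The operator `L` on a parametrized hypersurface. -/
def paramL (F ν : Euc n → Euc (n + 1)) (u : Euc n → ℝ) (y : Euc n) : ℝ :=
  paramDiv F (paramGrad F u) y + paramNormSqA F ν y * u y + (1 / 2) * u y -
    (1 / 2) * inner ℝ (F y) (paramGrad F u y)

theorem paramDiv_congr {F V W : Euc n → Euc (n + 1)} {y : Euc n} (h : V =ᶠ[nhds y] W) :
    paramDiv F V y = paramDiv F W y := by
  unfold paramDiv
  simp only [fun i => coordDeriv_congr h i]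

/-- The Riemannian volume density `√(det g)` of a parametrization. -/
def paramDensity (F : Euc n → Euc (n + 1)) (y : Euc n) : ℝ :=
  Real.sqrt (Matrix.gram ℝ (coordFrame F y)).det

theorem inner_paramGrad (F : Euc n → Euc (n + 1)) (u : Euc n → ℝ) (y : Euc n) (w : Euc (n + 1)) :
    inner ℝ (paramGrad F u y) w = ∑ k, coordDeriv k u y * inner ℝ w (coordDualFrame F k y) := by
  rw [real_inner_comm]
  simp only [paramGrad, inner_sum, real_inner_smul_right]

namespace IsParam

variable {F ν : Euc n → Euc (n + 1)} {U : Set (Euc n)} (h : IsParam F ν U) {y : Euc n} (hy : y ∈ U)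
include h hy

theorem paramGrad_congr {u u' : Euc n → ℝ} (huu' : Set.EqOn u u' U) :
    paramGrad F u y = paramGrad F u' y := by
  have : u =ᶠ[nhds y] u' := Filter.eventuallyEq_of_mem (h.mem_nhds hy) huu'
  unfold paramGrad
  simp only [fun i => coordDeriv_congr this i]

theorem paramL_congr {u u' : Euc n → ℝ} (huu' : Set.EqOn u u' U) :
    paramL F ν u y = paramL F ν u' y := by
  have : paramGrad F u =ᶠ[nhds y] paramGrad F u' :=
    Filter.eventuallyEq_of_mem (h.mem_nhds hy) fun z hz => h.paramGrad_congr hz huu'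
  rw [paramL, paramL, paramDiv_congr this, h.paramGrad_congr hy huu', huu' hy]

theorem inner_paramGrad_normal (u : Euc n → ℝ) : inner ℝ (paramGrad F u y) (ν y) = 0 := by
  simp [inner_paramGrad, h.inner_normal_dualFrame hy]

/-- Only `ν` is differentiated, as `∂ⱼV` is tangent. Self-adjointness of the shape operator then
brings the gradient to the form whose divergence is computed in `paramDiv_shape`. -/
theorem paramGrad_inner_normal {V : Euc n → Euc (n + 1)} (hV : DifferentiableAt ℝ V y)
    (hVν : ∀ j, inner ℝ (coordDeriv j V y) (ν y) = 0) :
    paramGrad F (fun z => inner ℝ (V z) (ν z)) y =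
      ∑ k, inner ℝ (V y) (coordDualFrame F k y) • coordDeriv k ν y := by
  rw [← h.sum_inner_smul_coordDualFrame hy]
  refine Finset.sum_congr rfl fun j _ => ?_
  rw [coordDeriv_inner hV ((h.contDiffAt_normal hy).differentiableAt (by simp)), hVν, add_zero]

/-- The operator `L` applied to `⟨V, ν⟩`, on a self-shrinker. -/
theorem paramL_inner_normal
    (hS : ∀ z ∈ U, paramMeanCurvature F ν z = inner ℝ (F z) (ν z) / 2)
    {V : Euc n → Euc (n + 1)} (hV : ∀ z ∈ U, DifferentiableAt ℝ V z)
    (hVν : ∀ z ∈ U, ∀ j, inner ℝ (coordDeriv j V z) (ν z) = 0) :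
    paramL F ν (fun z => inner ℝ (V z) (ν z)) y = (1 / 2) * inner ℝ (V y) (ν y) +
      ∑ i, ∑ k, inner ℝ (coordDeriv i V y) (coordDualFrame F k y) *
        inner ℝ (coordDeriv k ν y) (coordDualFrame F i y) := by
  have hgrad : paramGrad F (fun z => inner ℝ (V z) (ν z)) =ᶠ[nhds y]
      fun z => ∑ k, inner ℝ (V z) (coordDualFrame F k z) • coordDeriv k ν z :=
    Filter.eventuallyEq_of_mem (h.mem_nhds hy) fun z hz =>
      h.paramGrad_inner_normal hz (hV z hz) (hVν z hz)
  -- The shrinker equation enters here; the term `⟨∂ₖF, ν⟩` of the product rule vanishes.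
  have hH : ∀ k, coordDeriv k (paramMeanCurvature F ν) y =
      (1 / 2) * inner ℝ (F y) (coordDeriv k ν y) := fun k => by
    have hF := (h.contDiffAt hy).differentiableAt (by simp)
    have hν := (h.contDiffAt_normal hy).differentiableAt (by simp)
    have hcongr : paramMeanCurvature F ν =ᶠ[nhds y] fun z => (1 / 2 : ℝ) * inner ℝ (F z) (ν z) :=
      Filter.eventuallyEq_of_mem (h.mem_nhds hy) fun z hz => by rw [hS z hz]; ring
    rw [coordDeriv_congr hcongr, coordDeriv_mul (differentiableAt_const _) (hF.inner ℝ hν),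
      coordDeriv_inner hF hν, coordDeriv_const, h.inner_normal y hy]
    ring
  rw [paramL, paramDiv_congr hgrad, h.paramDiv_shape hy (hV y hy),
    h.paramGrad_inner_normal hy (hV y hy) (hVν y hy)]
  simp only [hH, inner_sum, real_inner_smul_right, Finset.mul_sum]
  have : ∀ k, inner ℝ (V y) (coordDualFrame F k y) * (1 / 2 * inner ℝ (F y) (coordDeriv k ν y)) =
      1 / 2 * (inner ℝ (V y) (coordDualFrame F k y) * inner ℝ (F y) (coordDeriv k ν y)) :=
    fun k => by ring
  simp only [this]
  ring

theorem paramL_inner_const_normal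
    (hS : ∀ z ∈ U, paramMeanCurvature F ν z = inner ℝ (F z) (ν z) / 2) (v : Euc (n + 1)) :
    paramL F ν (fun z => inner ℝ v (ν z)) y = (1 / 2) * inner ℝ v (ν y) := by
  rw [h.paramL_inner_normal hy hS (fun z _ => differentiableAt_const v)
    (fun z _ j => by rw [coordDeriv_const, inner_zero_left])]
  simp [coordDeriv_const]

/-- Take `V = F / 2`, so that `⟨V, ν⟩ = H`. Since `⟨∂ᵢF, θᵏ⟩ = δᵢₖ`, the extra sum collapses to `H /
2`. -/
theorem paramL_paramMeanCurvature
    (hS : ∀ z ∈ U, paramMeanCurvature F ν z = inner ℝ (F z) (ν z) / 2) :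
    paramL F ν (paramMeanCurvature F ν) y = paramMeanCurvature F ν y := by
  have hd : ∀ z ∈ U, DifferentiableAt ℝ F z := fun z hz =>
    (h.contDiffAt hz).differentiableAt (by simp)
  have hder : ∀ z ∈ U, ∀ j, coordDeriv j (fun z => (1 / 2 : ℝ) • F z) z =
      (1 / 2 : ℝ) • coordDeriv j F z := fun z hz j => by
    rw [coordDeriv_smul (differentiableAt_const _) (hd z hz), coordDeriv_const, zero_smul, add_zero]
  have heq : Set.EqOn (paramMeanCurvature F ν) (fun z => inner ℝ ((1 / 2 : ℝ) • F z) (ν z)) U :=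
    fun z hz => by
      change _ = inner ℝ ((1 / 2 : ℝ) • F z) (ν z)
      rw [hS z hz, real_inner_smul_left]
      ring
  rw [h.paramL_congr hy heq,
    h.paramL_inner_normal hy hS (V := fun z => (1 / 2 : ℝ) • F z) (fun z hz => (hd z hz).fun_const_smul _)
      (fun z hz j => by rw [hder z hz, real_inner_smul_left, h.inner_normal z hz, mul_zero])]
  simp only [hder y hy, real_inner_smul_left]
  have hδ : ∀ i k, inner ℝ (coordDeriv i F y) (coordDualFrame F k y) = if i = k then 1 else 0 :=
    inner_frame_dualFrame (h.linearIndependent y hy)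
  simp only [hδ, mul_ite, mul_one, mul_zero, ite_mul, zero_mul, Finset.sum_ite_eq, Finset.mem_univ,
    if_true, ← Finset.mul_sum]
  change _ + 1 / 2 * paramMeanCurvature F ν y = _
  rw [hS y hy]
  ring

/-! ### The volume density and the weighted divergence formula -/

theorem det_gram_pos : 0 < (Matrix.gram ℝ (coordFrame F y)).det :=
  (Matrix.posDef_gram_of_linearIndependent (h.linearIndependent y hy)).det_pos

theorem contDiffAt_paramDensity : ContDiffAt ℝ ∞ (paramDensity F) y :=
  (contDiffAt_det (contDiffAt_gram (t := coordFrame F) (h.contDiffAt_coordFrame hy))).sqrt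
    (h.det_gram_pos hy).ne'

/-- Jacobi's formula gives half the trace of `g⁻¹ ∂ₖg`; the two halves of `∂ₖgᵢⱼ` contribute
equally, which leaves the contracted Christoffel symbols `Γⁱₖᵢ`. -/
theorem coordDeriv_paramDensity (k : Fin n) :
    coordDeriv k (paramDensity F) y = paramDensity F y *
      ∑ i, inner ℝ (coordDeriv k (coordDeriv i F) y) (coordDualFrame F i y) := by
  have hg : ∀ i j, DifferentiableAt ℝ (fun z => Matrix.gram ℝ (coordFrame F z) i j) y :=
    fun i j => (contDiffAt_gram (t := coordFrame F) (h.contDiffAt_coordFrame hy) i j).differentiableAt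
      (by simp)
  have hpos := h.det_gram_pos hy
  have hdet : DifferentiableAt ℝ (fun z => (Matrix.gram ℝ (coordFrame F z)).det) y :=
    (contDiffAt_det (contDiffAt_gram (t := coordFrame F)
      (h.contDiffAt_coordFrame hy))).differentiableAt (n := ∞) (by simp)
  have hd := fun i => (h.contDiffAt_coordFrame hy i).differentiableAt (by simp)
  have hgd : ∀ i j, fderiv ℝ (fun z => Matrix.gram ℝ (coordFrame F z) i j) y
      (EuclideanSpace.single k 1) =
      inner ℝ (coordDeriv i F y) (coordDeriv k (coordDeriv j F) y) +
        inner ℝ (coordDeriv k (coordDeriv i F) y) (coordDeriv j F y) := fun i j =>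
    coordDeriv_inner (hd i) (hd j) k
  have hsum : ∑ i, ∑ j, (Matrix.gram ℝ (coordFrame F y))⁻¹ j i *
      (inner ℝ (coordDeriv i F y) (coordDeriv k (coordDeriv j F) y) +
        inner ℝ (coordDeriv k (coordDeriv i F) y) (coordDeriv j F y)) =
      2 * ∑ i, inner ℝ (coordDeriv k (coordDeriv i F) y) (coordDualFrame F i y) := by
    have h1 : ∑ i, inner ℝ (coordDeriv k (coordDeriv i F) y) (coordDualFrame F i y) =
        ∑ i, ∑ j, (Matrix.gram ℝ (coordFrame F y))⁻¹ j i *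
          inner ℝ (coordDeriv k (coordDeriv i F) y) (coordDeriv j F y) := by
      refine Finset.sum_congr rfl fun i _ => ?_
      simp only [coordDualFrame, dualFrame, inner_sum, real_inner_smul_right, coordFrame]
      exact Finset.sum_congr rfl fun j _ => by rw [gram_inv_symm]
    have h2 : ∑ i, ∑ j, (Matrix.gram ℝ (coordFrame F y))⁻¹ j i *
        inner ℝ (coordDeriv i F y) (coordDeriv k (coordDeriv j F) y) =
        ∑ i, ∑ j, (Matrix.gram ℝ (coordFrame F y))⁻¹ j i *
          inner ℝ (coordDeriv k (coordDeriv i F) y) (coordDeriv j F y) := by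
      rw [Finset.sum_comm]
      refine Finset.sum_congr rfl fun i _ => Finset.sum_congr rfl fun j _ => ?_
      rw [gram_inv_symm, real_inner_comm]
    simp only [mul_add, Finset.sum_add_distrib]
    rw [h1, h2]
    ring
  have hmain : coordDeriv k (paramDensity F) y =
      1 / (2 * Real.sqrt (Matrix.gram ℝ (coordFrame F y)).det) *
        fderiv ℝ (fun z => (Matrix.gram ℝ (coordFrame F z)).det) y (EuclideanSpace.single k 1) := by
    unfold coordDeriv paramDensity
    rw [fderiv_sqrt hdet hpos.ne']
    simp
  rw [hmain, fderiv_det_apply hg hpos.ne']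
  simp only [hgd]
  rw [hsum, paramDensity]
  have hs := Real.sqrt_pos.2 hpos
  nth_rewrite 2 [← Real.mul_self_sqrt hpos.le]
  field_simp

/-- The divergence formula `div V = (∂ₖ (√(det g) Vᵏ)) / √(det g)`, with a Gaussian weight. -/
theorem sum_coordDeriv_eq_paramDiv {V : Euc n → Euc (n + 1)} (hV : DifferentiableAt ℝ V y)
    (hVν : inner ℝ (V y) (ν y) = 0) :
    ∑ k, coordDeriv k (fun z => inner ℝ (V z) (coordDualFrame F k z) *
        (paramDensity F z * Real.exp (-‖F z‖ ^ 2 / 4))) y =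
      (paramDiv F V y - (1 / 2) * inner ℝ (F y) (V y)) *
        (paramDensity F y * Real.exp (-‖F y‖ ^ 2 / 4)) := by
  have hF := (h.contDiffAt hy).differentiableAt (by simp)
  have hθ := fun i => (h.contDiffAt_coordDualFrame hy i).differentiableAt (by simp)
  have hρ := (h.contDiffAt_paramDensity hy).differentiableAt (by simp)
  have hnorm : (fun z => Real.exp (-‖F z‖ ^ 2 / 4)) =
      fun z => Real.exp ((-1 / 4) * inner ℝ (F z) (F z)) := by
    funext z
    rw [real_inner_self_eq_norm_sq]
    congr 1
    ring
  have hE : DifferentiableAt ℝ (fun z => (-1 / 4 : ℝ) * inner ℝ (F z) (F z)) y :=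
    (differentiableAt_const _).mul (hF.inner ℝ hF)
  have hw : DifferentiableAt ℝ (fun z => Real.exp (-‖F z‖ ^ 2 / 4)) y := by
    rw [hnorm]
    exact hE.exp
  have hdw : ∀ k, coordDeriv k (fun z => Real.exp (-‖F z‖ ^ 2 / 4)) y =
      Real.exp (-‖F y‖ ^ 2 / 4) * (-(1 / 2) * inner ℝ (F y) (coordDeriv k F y)) := fun k => by
    have h1 : coordDeriv k (fun z => (-1 / 4 : ℝ) * inner ℝ (F z) (F z)) y =
        -(1 / 2) * inner ℝ (F y) (coordDeriv k F y) := by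
      rw [coordDeriv_mul (differentiableAt_const _) (hF.inner ℝ hF), coordDeriv_inner hF hF,
        coordDeriv_const, real_inner_comm (F y)]
      ring
    rw [← h1, congrFun hnorm y, hnorm]
    unfold coordDeriv
    rw [fderiv_exp hE]
    simp
  have hρw : DifferentiableAt ℝ (fun z => paramDensity F z * Real.exp (-‖F z‖ ^ 2 / 4)) y :=
    hρ.mul hw
  have e1 : ∀ k, inner ℝ (V y) (coordDeriv k (coordDualFrame F k) y) =
      -∑ j, inner ℝ (V y) (coordDualFrame F j y) *
        inner ℝ (coordDeriv k (coordDeriv j F) y) (coordDualFrame F k y) := fun k => by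
    rw [h.inner_eq_sum hy (V y), hVν, zero_mul, add_zero, ← Finset.sum_neg_distrib]
    refine Finset.sum_congr rfl fun j _ => ?_
    rw [real_inner_comm (coordDeriv j F y), h.inner_frame_coordDeriv_dualFrame hy, mul_neg]
  have hcommF : ∀ i k, coordDeriv i (coordDeriv k F) y = coordDeriv k (coordDeriv i F) y :=
    coordDeriv_comm ((h.contDiffAt hy).of_le ENat.LEInfty.out)
  -- By the symmetry of second derivatives, the Christoffel terms from differentiating `θᵏ` cancel
  -- those from differentiating `√(det g)`.
  have e2 : ∑ k, ∑ j, inner ℝ (V y) (coordDualFrame F j y) *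
        inner ℝ (coordDeriv k (coordDeriv j F) y) (coordDualFrame F k y) =
      ∑ k, inner ℝ (V y) (coordDualFrame F k y) *
        ∑ i, inner ℝ (coordDeriv k (coordDeriv i F) y) (coordDualFrame F i y) := by
    rw [Finset.sum_comm]
    refine Finset.sum_congr rfl fun j _ => ?_
    rw [Finset.mul_sum]
    exact Finset.sum_congr rfl fun i _ => by rw [hcommF i j]
  have e3 : inner ℝ (F y) (V y) =
      ∑ k, inner ℝ (V y) (coordDualFrame F k y) * inner ℝ (F y) (coordDeriv k F y) := by
    rw [real_inner_comm, h.inner_eq_sum hy (V y), hVν, zero_mul, add_zero]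
  have hterm : ∀ k, coordDeriv k (fun z => inner ℝ (V z) (coordDualFrame F k z) *
        (paramDensity F z * Real.exp (-‖F z‖ ^ 2 / 4))) y =
      (inner ℝ (V y) (coordDualFrame F k y) *
          ∑ i, inner ℝ (coordDeriv k (coordDeriv i F) y) (coordDualFrame F i y) -
        (1 / 2) * (inner ℝ (V y) (coordDualFrame F k y) * inner ℝ (F y) (coordDeriv k F y)) -
        ∑ j, inner ℝ (V y) (coordDualFrame F j y) *
          inner ℝ (coordDeriv k (coordDeriv j F) y) (coordDualFrame F k y) +
        inner ℝ (coordDeriv k V y) (coordDualFrame F k y)) *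
        (paramDensity F y * Real.exp (-‖F y‖ ^ 2 / 4)) := fun k => by
    rw [coordDeriv_mul (hV.inner ℝ (hθ k)) hρw, coordDeriv_mul hρ hw, hdw,
      h.coordDeriv_paramDensity hy, coordDeriv_inner hV (hθ k), e1]
    ring
  simp only [hterm]
  rw [← Finset.sum_mul, e3, paramDiv]
  simp only [Finset.sum_add_distrib, Finset.sum_sub_distrib, ← Finset.mul_sum]
  rw [e2]
  ring

/-! ### Regularity of the parametrized objects -/

theorem contDiffAt_paramGrad {m : WithTop ℕ∞} (hm : m ≤ ∞) {u : Euc n → ℝ}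
    (hu : ContDiffAt ℝ (m + 1) u y) : ContDiffAt ℝ m (paramGrad F u) y :=
  ContDiffAt.sum fun i _ =>
    (contDiffAt_coordDeriv hu le_rfl i).smul ((h.contDiffAt_coordDualFrame hy i).of_le hm)

theorem continuousAt_paramNormSqA : ContinuousAt (paramNormSqA F ν) y := by
  refine tendsto_finsetSum _ fun i _ => tendsto_finsetSum _ fun k _ => ?_
  have hc := fun i => (h.contDiffAt_coordDeriv_normal hy i).continuousAt
  have hθ := fun i => (h.contDiffAt_coordDualFrame hy i).continuousAt
  exact ((hc i).inner (𝕜 := ℝ) (hθ k)).mul ((hc k).inner (𝕜 := ℝ) (hθ i))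

theorem continuousAt_paramL {u : Euc n → ℝ} (hu : ContDiffAt ℝ 2 u y) :
    ContinuousAt (paramL F ν u) y := by
  have hG : ContDiffAt ℝ 1 (paramGrad F u) y :=
    h.contDiffAt_paramGrad hy (by simp) (by rwa [one_add_one_eq_two])
  have hdiv : ContinuousAt (paramDiv F (paramGrad F u)) y := by
    refine tendsto_finsetSum _ fun i _ => ?_
    exact (contDiffAt_coordDeriv (m := 0) hG (by simp) i).continuousAt.inner (𝕜 := ℝ)
      (h.contDiffAt_coordDualFrame hy i).continuousAt
  exact ((hdiv.add ((h.continuousAt_paramNormSqA hy).mul hu.continuousAt)).add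
    (continuousAt_const.mul hu.continuousAt)).sub
    (continuousAt_const.mul ((h.contDiffAt hy).continuousAt.inner (𝕜 := ℝ) hG.continuousAt))

end IsParam

end Param

/-! ### Invariance of the geometric objects under a change of chart -/

section Chart

variable {n : ℕ} {M : Type*} [TopologicalSpace M] [ChartedSpace (Euc n) M]

theorem contDiffOn_comp_chart_symm [IsManifold (𝓡 n) ∞ M] {G : Type*} [NormedAddCommGroup G]
    [NormedSpace ℝ G] {k : WithTop ℕ∞} (hk : k ≤ ∞) {V : M → G}
    (hV : ContMDiff (𝓡 n) 𝓘(ℝ, G) k V) {e : OpenPartialHomeomorph M (Euc n)}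
    (he : e ∈ atlas (Euc n) M) : ContDiffOn ℝ k (V ∘ e.symm) e.target := by
  have h1 : ContMDiffOn (𝓡 n) (𝓡 n) k e.symm e.target :=
    (contMDiffOn_symm_of_mem_maximalAtlas (n := ∞)
      (IsManifold.subset_maximalAtlas he)).of_le hk
  exact contMDiffOn_iff_contDiffOn.1 (hV.comp_contMDiffOn h1)

theorem contDiffAt_comp_chart_symm [IsManifold (𝓡 n) ∞ M] {G : Type*} [NormedAddCommGroup G]
    [NormedSpace ℝ G] {k : WithTop ℕ∞} (hk : k ≤ ∞) {V : M → G}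
    (hV : ContMDiff (𝓡 n) 𝓘(ℝ, G) k V) {e : OpenPartialHomeomorph M (Euc n)}
    (he : e ∈ atlas (Euc n) M) {y : Euc n} (hy : y ∈ e.target) :
    ContDiffAt ℝ k (V ∘ e.symm) y :=
  (contDiffOn_comp_chart_symm hk hV he).contDiffAt (e.open_target.mem_nhds hy)

variable {e e' : OpenPartialHomeomorph M (Euc n)}

theorem contDiffOn_transition [IsManifold (𝓡 n) ∞ M]
    (he : e ∈ atlas (Euc n) M) (he' : e' ∈ atlas (Euc n) M) :
    ContDiffOn ℝ ∞ (e' ∘ e.symm) (e.symm.trans e').source := by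
  have h1 : ContMDiffOn (𝓡 n) (𝓡 n) ∞ e.symm e.target :=
    contMDiffOn_symm_of_mem_maximalAtlas (IsManifold.subset_maximalAtlas he)
  have h2 : ContMDiffOn (𝓡 n) (𝓡 n) ∞ e' e'.source :=
    contMDiffOn_of_mem_maximalAtlas (IsManifold.subset_maximalAtlas he')
  refine contMDiffOn_iff_contDiffOn.1 ?_
  rw [OpenPartialHomeomorph.trans_source]
  exact h2.comp (h1.mono Set.inter_subset_left) Set.inter_subset_right

theorem contDiffAt_transition [IsManifold (𝓡 n) ∞ M]
    (he : e ∈ atlas (Euc n) M) (he' : e' ∈ atlas (Euc n) M) {p : M} (hp : p ∈ e.source)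
    (hp' : p ∈ e'.source) : ContDiffAt ℝ ∞ (e' ∘ e.symm) (e p) := by
  refine (contDiffOn_transition he he').contDiffAt ((e.symm.trans e').open_source.mem_nhds ?_)
  simp [hp, hp']

/-- The Jacobian matrix at `p` of the coordinates `e'` with respect to the coordinates `e`. -/
def jacobian (e e' : OpenPartialHomeomorph M (Euc n)) (p : M) : Matrix (Fin n) (Fin n) ℝ :=
  Matrix.of fun i k => coordDeriv i (e' ∘ e.symm) (e p) k

theorem coordDeriv_change [IsManifold (𝓡 n) ∞ M] {G : Type*} [NormedAddCommGroup G]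
    [NormedSpace ℝ G] (he : e ∈ atlas (Euc n) M) (he' : e' ∈ atlas (Euc n) M) {p : M}
    (hp : p ∈ e.source) (hp' : p ∈ e'.source) {V : M → G}
    (hV : DifferentiableAt ℝ (V ∘ e'.symm) (e' p)) (i : Fin n) :
    coordDeriv i (V ∘ e.symm) (e p) =
      ∑ k, jacobian e e' p i k • coordDeriv k (V ∘ e'.symm) (e' p) := by
  have hΦ : DifferentiableAt ℝ (e' ∘ e.symm) (e p) :=
    (contDiffAt_transition he he' hp hp').differentiableAt (by simp)
  have heq : V ∘ e.symm =ᶠ[nhds (e p)] (V ∘ e'.symm) ∘ (e' ∘ e.symm) := by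
    have : (e.symm.trans e').source ∈ nhds (e p) :=
      (e.symm.trans e').open_source.mem_nhds (by simp [hp, hp'])
    filter_upwards [this] with z hz
    rw [OpenPartialHomeomorph.trans_source] at hz
    simp only [Function.comp_apply]
    rw [e'.left_inv hz.2]
  have hpt : (e' ∘ e.symm) (e p) = e' p := by simp [e.left_inv hp]
  rw [coordDeriv_congr heq]
  unfold coordDeriv
  rw [fderiv_comp _ (by rwa [hpt]) hΦ, hpt, ContinuousLinearMap.comp_apply]
  have hsum : ∀ w : Euc n, w = ∑ k, w k • EuclideanSpace.single k (1 : ℝ) := fun w => by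
    ext l
    simp [Pi.single_apply]
  conv_lhs => rw [hsum (fderiv ℝ (e' ∘ e.symm) (e p) (EuclideanSpace.single i 1)), map_sum]
  simp only [map_smul]
  rfl

/-- The chain rule `coordDeriv_change` applied to the coordinate map `e` itself, which is the
identity when read in `e`. -/
theorem jacobian_mul_jacobian [IsManifold (𝓡 n) ∞ M] (he : e ∈ atlas (Euc n) M)
    (he' : e' ∈ atlas (Euc n) M) {p : M} (hp : p ∈ e.source) (hp' : p ∈ e'.source) :
    jacobian e e' p * jacobian e' e p = 1 := by
  ext i l
  have h := coordDeriv_change he he' hp hp' (V := e)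
    ((contDiffAt_transition he' he hp' hp).differentiableAt (by simp)) i
  have hid : e ∘ e.symm =ᶠ[nhds (e p)] id := by
    filter_upwards [e.open_target.mem_nhds (e.map_source hp)] with z hz using e.right_inv hz
  rw [coordDeriv_congr hid] at h
  have h2 := congrArg (fun w : Euc n => w l) h
  simp only [coordDeriv, fderiv_id] at h2
  rw [Matrix.mul_apply, Matrix.one_apply]
  simp only [jacobian, Matrix.of_apply, coordDeriv]
  simpa [PiLp.single_apply, eq_comm, jacobian, coordDeriv] using h2.symm

theorem IsHypersurface.isParam [IsManifold (𝓡 n) ∞ M] {X N : M → Euc (n + 1)}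
    (hX : IsHypersurface X N) (he : e ∈ atlas (Euc n) M) :
    IsParam (X ∘ e.symm) (N ∘ e.symm) e.target := by
  have hder : ∀ y ∈ e.target, ∀ w : Euc n, fderiv ℝ (X ∘ e.symm) y w =
      mfderiv (𝓡 n) 𝓘(ℝ, Euc (n + 1)) X (e.symm y) (mfderiv (𝓡 n) (𝓡 n) e.symm y w) := by
    intro y hy w
    have hX' : MDifferentiableAt (𝓡 n) 𝓘(ℝ, Euc (n + 1)) X (e.symm y) :=
      hX.smooth.mdifferentiable (by simp) _
    have he' : MDifferentiableAt (𝓡 n) (𝓡 n) e.symm y := mdifferentiableAt_atlas_symm he hy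
    rw [← mfderiv_eq_fderiv, mfderiv_comp y hX' he']
    rfl
  refine ⟨e.open_target, contDiffOn_comp_chart_symm le_rfl hX.smooth he,
    contDiffOn_comp_chart_symm le_rfl hX.smooth_normal he, fun y hy => ?_, fun y _ => hX.norm_normal _,
    fun y hy i => ?_⟩
  · have hinj : Function.Injective (fderiv ℝ (X ∘ e.symm) y) := by
      have : (fderiv ℝ (X ∘ e.symm) y : Euc n → Euc (n + 1)) =
          (mfderiv (𝓡 n) 𝓘(ℝ, Euc (n + 1)) X (e.symm y)) ∘ (mfderiv (𝓡 n) (𝓡 n) e.symm y) :=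
        funext (hder y hy)
      rw [this]
      exact (hX.immersion _).comp
        ((mdifferentiable_of_mem_atlas (I := 𝓡 n) he).symm.mfderiv_injective hy)
    have hli := (EuclideanSpace.orthonormal_single (ι := Fin n) (𝕜 := ℝ)).linearIndependent
    exact hli.map' (fderiv ℝ (X ∘ e.symm) y).toLinearMap (LinearMap.ker_eq_bot.2 hinj)
  · rw [coordDeriv, hder y hy]
    exact hX.normal _ _

theorem div_eq_paramDiv_chartAt (X V : M → Euc (n + 1)) (p : M) :
    div X V p = paramDiv (X ∘ (chartAt (Euc n) p).symm) (V ∘ (chartAt (Euc n) p).symm)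
      (chartAt (Euc n) p p) := by
  simp only [div, paramDiv, coordDualFrame, dualFrame, inner_sum, real_inner_smul_right]
  rfl

theorem grad_eq_paramGrad_chartAt (X : M → Euc (n + 1)) (u : M → ℝ) (p : M) :
    grad X u p = paramGrad (X ∘ (chartAt (Euc n) p).symm) (u ∘ (chartAt (Euc n) p).symm)
      (chartAt (Euc n) p p) := by
  simp only [grad, paramGrad, coordDualFrame, dualFrame, Finset.smul_sum, smul_smul]
  refine Finset.sum_congr rfl fun i _ => Finset.sum_congr rfl fun j _ => ?_
  rw [mul_comm]
  rfl

theorem continuous_of_chart {f : M → ℝ}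
    (h : ∀ e ∈ atlas (Euc n) M, ContinuousOn (f ∘ e.symm) e.target) :
    Continuous f := by
  refine continuous_iff_continuousAt.2 fun p => ?_
  have hp := mem_chart_source (Euc n) p
  set e := chartAt (Euc n) p
  have h1 : ContinuousAt ((f ∘ e.symm) ∘ e) p :=
    ((h e (chart_mem_atlas _ p)).continuousAt (e.open_target.mem_nhds (e.map_source hp))).comp
      (e.continuousAt hp)
  refine h1.congr ?_
  filter_upwards [e.open_source.mem_nhds hp] with q hq
  simp [e.left_inv hq]

variable [IsManifold (𝓡 n) ∞ M] {X N : M → Euc (n + 1)}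

theorem coordDualFrame_change (hX : IsHypersurface X N) (he : e ∈ atlas (Euc n) M)
    (he' : e' ∈ atlas (Euc n) M) {p : M} (hp : p ∈ e.source) (hp' : p ∈ e'.source) (k : Fin n) :
    coordDualFrame (X ∘ e'.symm) k (e' p) =
      ∑ i, jacobian e e' p i k • coordDualFrame (X ∘ e.symm) i (e p) :=
  dualFrame_change ((hX.isParam he).linearIndependent _ (e.map_source hp))
    ((hX.isParam he').linearIndependent _ (e'.map_source hp'))
    (coordDeriv_change he he' hp hp'
      (((hX.isParam he').contDiffAt (e'.map_source hp')).differentiableAt (by simp)))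
    (jacobian_mul_jacobian he' he hp' hp) k

/-- Derivatives in `e` are `J` times those in `e'`, while the dual frame of `e'` is `Jᵀ` times that
of `e`; the contraction of the two is invariant. -/
theorem paramGrad_change (hX : IsHypersurface X N) (he : e ∈ atlas (Euc n) M)
    (he' : e' ∈ atlas (Euc n) M) {p : M} (hp : p ∈ e.source) (hp' : p ∈ e'.source) {u : M → ℝ}
    (hu : DifferentiableAt ℝ (u ∘ e'.symm) (e' p)) :
    paramGrad (X ∘ e.symm) (u ∘ e.symm) (e p) =
      paramGrad (X ∘ e'.symm) (u ∘ e'.symm) (e' p) := by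
  simp only [paramGrad, coordDeriv_change he he' hp hp' hu,
    coordDualFrame_change hX he he' hp hp', Finset.sum_smul, Finset.smul_sum, smul_smul, smul_eq_mul]
  rw [Finset.sum_comm]
  simp only [mul_comm]

theorem paramDiv_change (hX : IsHypersurface X N) (he : e ∈ atlas (Euc n) M)
    (he' : e' ∈ atlas (Euc n) M) {p : M} (hp : p ∈ e.source) (hp' : p ∈ e'.source)
    {V : M → Euc (n + 1)} (hV : DifferentiableAt ℝ (V ∘ e'.symm) (e' p)) :
    paramDiv (X ∘ e.symm) (V ∘ e.symm) (e p) =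
      paramDiv (X ∘ e'.symm) (V ∘ e'.symm) (e' p) := by
  simp only [paramDiv, coordDeriv_change he he' hp hp' hV,
    coordDualFrame_change hX he he' hp hp', sum_inner, inner_sum, real_inner_smul_left,
    real_inner_smul_right]
  rw [Finset.sum_comm]

/-- `|A|²` is the trace of the square of the Weingarten matrix. If `P` pairs the derivatives of `N`
in `e'` with the dual frame of `e`, the Weingarten matrices in the two charts are `J P` and `P J`,
whose squares have the same trace. -/
theorem paramNormSqA_change (hX : IsHypersurface X N) (he : e ∈ atlas (Euc n) M)
    (he' : e' ∈ atlas (Euc n) M) {p : M} (hp : p ∈ e.source) (hp' : p ∈ e'.source) :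
    paramNormSqA (X ∘ e.symm) (N ∘ e.symm) (e p) =
      paramNormSqA (X ∘ e'.symm) (N ∘ e'.symm) (e' p) := by
  have hN := ((hX.isParam he').contDiffAt_normal (e'.map_source hp')).differentiableAt (by simp)
  have htr : ∀ e : OpenPartialHomeomorph M (Euc n),
      paramNormSqA (X ∘ e.symm) (N ∘ e.symm) (e p) = Matrix.trace
        ((Matrix.of fun i k =>
          inner ℝ (coordDeriv i (N ∘ e.symm) (e p)) (coordDualFrame (X ∘ e.symm) k (e p))) *
        (Matrix.of fun i k =>
          inner ℝ (coordDeriv i (N ∘ e.symm) (e p)) (coordDualFrame (X ∘ e.symm) k (e p)))) :=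
    fun e => by simp [paramNormSqA, Matrix.trace, Matrix.mul_apply]
  set P : Matrix (Fin n) (Fin n) ℝ := Matrix.of fun a k =>
    inner ℝ (coordDeriv a (N ∘ e'.symm) (e' p)) (coordDualFrame (X ∘ e.symm) k (e p)) with hP
  have h1 : (Matrix.of fun i k => inner ℝ (coordDeriv i (N ∘ e.symm) (e p))
      (coordDualFrame (X ∘ e.symm) k (e p))) = jacobian e e' p * P := by
    ext i k
    simp only [coordDeriv_change he he' hp hp' hN, Matrix.of_apply, Matrix.mul_apply, hP, sum_inner,
      real_inner_smul_left]
  have h2 : (Matrix.of fun i k => inner ℝ (coordDeriv i (N ∘ e'.symm) (e' p))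
      (coordDualFrame (X ∘ e'.symm) k (e' p))) = P * jacobian e e' p := by
    ext i k
    simp only [coordDualFrame_change hX he he' hp hp', Matrix.of_apply, Matrix.mul_apply, hP,
      inner_sum, real_inner_smul_right, mul_comm]
  rw [htr e, htr e', h1, h2, Matrix.mul_assoc, Matrix.trace_mul_comm]
  simp only [Matrix.mul_assoc]

/-- Here `aᵢⱼ = -⟨∂ᵢN, ∂ⱼX⟩`, with a sign that disappears in the square, and contracting an index
with `g⁻¹` amounts to pairing with the dual frame. -/
theorem normSqA_eq_paramNormSqA_chartAt (hX : IsHypersurface X N) (p : M) :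
    normSqA X N p = paramNormSqA (X ∘ (chartAt (Euc n) p).symm) (N ∘ (chartAt (Euc n) p).symm)
      (chartAt (Euc n) p p) := by
  set e := chartAt (Euc n) p with he
  have h := hX.isParam (chart_mem_atlas (Euc n) p)
  rw [← he] at h
  have hy : e p ∈ e.target := e.map_source (mem_chart_source (Euc n) p)
  have hA : ∀ i j, secondFundamentalForm X N e p i j =
      -inner ℝ (coordDeriv i (N ∘ e.symm) (e p)) (coordDeriv j (X ∘ e.symm) (e p)) := fun i j => by
    rw [h.inner_coordDeriv_normal_frame hy, neg_neg, real_inner_comm, Function.comp_apply,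
      e.left_inv (mem_chart_source (Euc n) p)]
    rfl
  have hθ : ∀ i k, inner ℝ (coordDeriv i (N ∘ e.symm) (e p)) (coordDualFrame (X ∘ e.symm) k (e p)) =
      ∑ l, invMetric X e p k l *
        inner ℝ (coordDeriv i (N ∘ e.symm) (e p)) (coordDeriv l (X ∘ e.symm) (e p)) := fun i k => by
    simp only [coordDualFrame, dualFrame, inner_sum, real_inner_smul_right]
    rfl
  have hsymm : ∀ i k, invMetric X e p i k = invMetric X e p k i :=
    gram_inv_symm (coordFrame (X ∘ e.symm) (e p))
  unfold normSqA
  rw [← he]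
  simp only [paramNormSqA, hA, hθ, Finset.sum_mul_sum]
  refine Finset.sum_congr rfl fun i _ => ?_
  rw [Finset.sum_comm_cycle]
  refine Finset.sum_congr rfl fun k _ => Finset.sum_congr rfl fun l _ =>
    Finset.sum_congr rfl fun m _ => ?_
  rw [hsymm l k, h.inner_coordDeriv_normal_frame_comm hy m k]
  ring

/-- The preferred chart used by `grad` varies with the point. Reading the gradient in one fixed
chart is what allows it to be differentiated. -/
theorem grad_eq_paramGrad (hX : IsHypersurface X N) (he : e ∈ atlas (Euc n) M) {u : M → ℝ}
    (hu : ContMDiff (𝓡 n) 𝓘(ℝ, ℝ) 1 u) {p : M} (hp : p ∈ e.source) :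
    grad X u p = paramGrad (X ∘ e.symm) (u ∘ e.symm) (e p) := by
  rw [grad_eq_paramGrad_chartAt]
  exact paramGrad_change hX (chart_mem_atlas _ p) he (mem_chart_source _ p) hp
    ((contDiffAt_comp_chart_symm (by simp) hu he (e.map_source hp)).differentiableAt (by simp))

theorem div_eq_paramDiv (hX : IsHypersurface X N) (he : e ∈ atlas (Euc n) M) {V : M → Euc (n + 1)}
    {p : M} (hp : p ∈ e.source) (hV : DifferentiableAt ℝ (V ∘ e.symm) (e p)) :
    div X V p = paramDiv (X ∘ e.symm) (V ∘ e.symm) (e p) := by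
  rw [div_eq_paramDiv_chartAt]
  exact paramDiv_change hX (chart_mem_atlas _ p) he (mem_chart_source _ p) hp hV

theorem meanCurvature_eq_paramMeanCurvature (hX : IsHypersurface X N) (he : e ∈ atlas (Euc n) M)
    {p : M} (hp : p ∈ e.source) :
    meanCurvature X N p = paramMeanCurvature (X ∘ e.symm) (N ∘ e.symm) (e p) :=
  div_eq_paramDiv hX he hp
    (((hX.isParam he).contDiffAt_normal (e.map_source hp)).differentiableAt (by simp))

theorem normSqA_eq_paramNormSqA (hX : IsHypersurface X N) (he : e ∈ atlas (Euc n) M)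
    {p : M} (hp : p ∈ e.source) :
    normSqA X N p = paramNormSqA (X ∘ e.symm) (N ∘ e.symm) (e p) := by
  rw [normSqA_eq_paramNormSqA_chartAt hX]
  exact paramNormSqA_change hX (chart_mem_atlas _ p) he (mem_chart_source _ p) hp

theorem eqOn_grad_paramGrad (hX : IsHypersurface X N) (he : e ∈ atlas (Euc n) M) {u : M → ℝ}
    (hu : ContMDiff (𝓡 n) 𝓘(ℝ, ℝ) 1 u) :
    Set.EqOn (grad X u ∘ e.symm) (paramGrad (X ∘ e.symm) (u ∘ e.symm)) e.target := fun z hz => by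
  rw [Function.comp_apply, grad_eq_paramGrad hX he hu (e.map_target hz), e.right_inv hz]

theorem opL_eq_paramL (hX : IsHypersurface X N) (he : e ∈ atlas (Euc n) M) {u : M → ℝ}
    (hu : ContMDiff (𝓡 n) 𝓘(ℝ, ℝ) 2 u) {p : M} (hp : p ∈ e.source) :
    opL X N u p = paramL (X ∘ e.symm) (N ∘ e.symm) (u ∘ e.symm) (e p) := by
  have hu1 : ContMDiff (𝓡 n) 𝓘(ℝ, ℝ) 1 u := hu.of_le (by norm_num)
  have hy := e.map_source hp
  have hG : grad X u ∘ e.symm =ᶠ[nhds (e p)] paramGrad (X ∘ e.symm) (u ∘ e.symm) :=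
    Filter.eventuallyEq_of_mem (e.open_target.mem_nhds hy) (eqOn_grad_paramGrad hX he hu1)
  have hGd : DifferentiableAt ℝ (paramGrad (X ∘ e.symm) (u ∘ e.symm)) (e p) :=
    ((hX.isParam he).contDiffAt_paramGrad hy (m := 1) (by simp) (by
      rw [one_add_one_eq_two]
      exact contDiffAt_comp_chart_symm ENat.LEInfty.out hu he hy)).differentiableAt (by simp)
  rw [opL, laplacian, div_eq_paramDiv hX he hp (hG.differentiableAt_iff.2 hGd), paramDiv_congr hG,
    normSqA_eq_paramNormSqA hX he hp, grad_eq_paramGrad hX he hu1 hp, paramL]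
  simp only [Function.comp_apply, e.left_inv hp]

theorem continuous_opL (hX : IsHypersurface X N) {u : M → ℝ}
    (hu : ContMDiff (𝓡 n) 𝓘(ℝ, ℝ) 2 u) : Continuous (opL X N u) := by
  refine continuous_of_chart (n := n) fun e he => ?_
  have : ContinuousOn (paramL (X ∘ e.symm) (N ∘ e.symm) (u ∘ e.symm)) e.target := fun y hy =>
    ((hX.isParam he).continuousAt_paramL hy
      (contDiffAt_comp_chart_symm ENat.LEInfty.out hu he hy)).continuousWithinAt
  refine this.congr fun z hz => ?_
  rw [Function.comp_apply, opL_eq_paramL hX he hu (e.map_target hz), e.right_inv hz]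

theorem continuous_normSqA (hX : IsHypersurface X N) : Continuous (normSqA X N) := by
  refine continuous_of_chart (n := n) fun e he => ?_
  have : ContinuousOn (paramNormSqA (X ∘ e.symm) (N ∘ e.symm)) e.target := fun y hy =>
    ((hX.isParam he).continuousAt_paramNormSqA hy).continuousWithinAt
  refine this.congr fun z hz => ?_
  rw [Function.comp_apply, normSqA_eq_paramNormSqA hX he (e.map_target hz), e.right_inv hz]

theorem continuous_inner_grad (hX : IsHypersurface X N) {u v : M → ℝ}
    (hu : ContMDiff (𝓡 n) 𝓘(ℝ, ℝ) 1 u) (hv : ContMDiff (𝓡 n) 𝓘(ℝ, ℝ) 1 v) :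
    Continuous fun p => inner ℝ (grad X u p) (grad X v p) := by
  refine continuous_of_chart (n := n) fun e he => ?_
  have hc : ∀ {u : M → ℝ}, ContMDiff (𝓡 n) 𝓘(ℝ, ℝ) 1 u →
      ContinuousOn (grad X u ∘ e.symm) e.target := fun {u} hu => by
    have : ContinuousOn (paramGrad (X ∘ e.symm) (u ∘ e.symm)) e.target := fun y hy =>
      ((hX.isParam he).contDiffAt_paramGrad hy (m := 0) (by simp) (by
        rw [zero_add]
        exact contDiffAt_comp_chart_symm (by simp) hu he hy)).continuousAt.continuousWithinAt
    exact this.congr (eqOn_grad_paramGrad hX he hu)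
  exact (hc hu).inner (𝕜 := ℝ) (hc hv)

theorem continuous_gaussWeight (hX : IsHypersurface X N) : Continuous (gaussWeight X) := by
  have := hX.smooth.continuous
  unfold gaussWeight
  fun_prop

/-! ### The eigenfunctions -/

theorem contMDiff_inner_normal (hX : IsHypersurface X N) (v : Euc (n + 1)) :
    ContMDiff (𝓡 n) 𝓘(ℝ, ℝ) ∞ (fun q => inner ℝ v (N q)) :=
  (innerSL ℝ v).contMDiff.comp hX.smooth_normal

theorem contMDiff_meanCurvature (hX : IsHypersurface X N) (hS : IsSelfShrinker X N) :
    ContMDiff (𝓡 n) 𝓘(ℝ, ℝ) ∞ (meanCurvature X N) := by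
  rw [show meanCurvature X N = fun p => inner ℝ (X p) (N p) / 2 from funext hS]
  have h : ContDiff ℝ ∞ (fun z : Euc (n + 1) × Euc (n + 1) => (inner ℝ z.1 z.2 : ℝ) / 2) :=
    (contDiff_fst.inner ℝ contDiff_snd).div_const _
  exact h.contMDiff.comp (hX.smooth.prodMk_space hX.smooth_normal)

theorem opL_meanCurvature (hX : IsHypersurface X N) (hS : IsSelfShrinker X N) (p : M) :
    opL X N (meanCurvature X N) p = meanCurvature X N p := by
  have he := chart_mem_atlas (Euc n) p
  have hp := mem_chart_source (Euc n) p
  set e := chartAt (Euc n) p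
  have hH : Set.EqOn (meanCurvature X N ∘ e.symm)
      (paramMeanCurvature (X ∘ e.symm) (N ∘ e.symm)) e.target := fun z hz => by
    rw [Function.comp_apply, meanCurvature_eq_paramMeanCurvature hX he (e.map_target hz), e.right_inv hz]
  rw [opL_eq_paramL hX he ((contMDiff_meanCurvature hX hS).of_le ENat.LEInfty.out) hp,
    (hX.isParam he).paramL_congr (e.map_source hp) hH,
    (hX.isParam he).paramL_paramMeanCurvature (e.map_source hp) fun z hz => by
      rw [← hH hz]; exact hS _,
    meanCurvature_eq_paramMeanCurvature hX he hp]

theorem opL_inner_normal (hX : IsHypersurface X N) (hS : IsSelfShrinker X N) (v : Euc (n + 1))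
    (p : M) : opL X N (fun q => inner ℝ v (N q)) p = (1 / 2) * inner ℝ v (N p) := by
  have he := chart_mem_atlas (Euc n) p
  have hp := mem_chart_source (Euc n) p
  set e := chartAt (Euc n) p
  have h := (hX.isParam he).paramL_inner_const_normal (e.map_source hp) (fun z hz => by
    rw [← e.right_inv hz, ← meanCurvature_eq_paramMeanCurvature hX he (e.map_target hz),
      e.right_inv hz]
    exact hS _) v
  rw [opL_eq_paramL hX he ((contMDiff_inner_normal hX v).of_le ENat.LEInfty.out) hp]
  refine h.trans ?_
  rw [Function.comp_apply, e.left_inv hp]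

end Chart

/-! ### The volume measure in a chart -/

section Volume

variable {n : ℕ} {M : Type*} [TopologicalSpace M] {e e' : OpenPartialHomeomorph M (Euc n)}

theorem paramDensity_nonneg (F : Euc n → Euc (n + 1)) (y : Euc n) : 0 ≤ paramDensity F y :=
  Real.sqrt_nonneg _

theorem metric_chart_symm (X : M → Euc (n + 1)) {y : Euc n} (hy : y ∈ e.target) :
    metric X e (e.symm y) = Matrix.gram ℝ (coordFrame (X ∘ e.symm) y) := by
  ext i j
  simp [metric, partialD, coordFrame, coordDeriv, Matrix.gram_apply, e.right_inv hy]

/-- `jacobian` stores the derivative along the `i`-th coordinate in its `i`-th row, so it is the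
transpose of the matrix of the differential. -/
theorem det_fderiv_transition (e e' : OpenPartialHomeomorph M (Euc n)) (p : M) :
    (fderiv ℝ (e' ∘ e.symm) (e p)).det = (jacobian e e' p).det := by
  have h : LinearMap.toMatrix (EuclideanSpace.basisFun (Fin n) ℝ).toBasis
      (EuclideanSpace.basisFun (Fin n) ℝ).toBasis
      (fderiv ℝ (e' ∘ e.symm) (e p)).toLinearMap = (jacobian e e' p).transpose := by
    ext i j
    simp [LinearMap.toMatrix_apply, jacobian, coordDeriv]
  rw [ContinuousLinearMap.det, ← LinearMap.det_toMatrix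
    (EuclideanSpace.basisFun (Fin n) ℝ).toBasis, h, Matrix.det_transpose]

section Measurable

variable [MeasurableSpace M]

theorem chartVolume_eq_map_withDensity (X : M → Euc (n + 1)) (e : OpenPartialHomeomorph M (Euc n)) :
    chartVolume X e = ((volume.restrict e.target).withDensity
      fun y => ENNReal.ofReal (paramDensity (X ∘ e.symm) y)).map e.symm := by
  rw [chartVolume]
  congr 1
  refine withDensity_congr_ae ?_
  filter_upwards [ae_restrict_mem e.open_target.measurableSet] with y hy
  rw [metric_chart_symm X hy, paramDensity]

variable [BorelSpace M]

theorem measurableSet_target_inter_preimage (e : OpenPartialHomeomorph M (Euc n)) {s : Set M}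
    (hs : MeasurableSet s) : MeasurableSet (e.target ∩ e.symm ⁻¹' s) := by
  have h : Measurable (e.target.domRestrict e.symm) :=
    (continuousOn_iff_continuous_domRestrict.1 e.continuousOn_symm).measurable
  have := MeasurableSet.subtype_image e.open_target.measurableSet (h hs)
  convert this using 1
  ext y
  simp [Set.domRestrict, and_comm]

theorem aemeasurable_chart_symm (e : OpenPartialHomeomorph M (Euc n)) (ρ : Euc n → ENNReal) :
    AEMeasurable e.symm ((volume.restrict e.target).withDensity ρ) :=
  (e.continuousOn_symm.aemeasurable e.open_target.measurableSet).mono_ac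
    (withDensity_absolutelyContinuous _ _)

theorem chartVolume_apply (X : M → Euc (n + 1)) (e : OpenPartialHomeomorph M (Euc n)) {s : Set M}
    (hs : MeasurableSet s) :
    chartVolume X e s =
      ∫⁻ y in e.target ∩ e.symm ⁻¹' s, ENNReal.ofReal (paramDensity (X ∘ e.symm) y) := by
  rw [chartVolume, Measure.map_apply_of_aemeasurable (aemeasurable_chart_symm e _) hs,
    withDensity_apply' _, Measure.restrict_restrict' e.open_target.measurableSet, Set.inter_comm]
  refine setLIntegral_congr_fun (measurableSet_target_inter_preimage e hs) fun y hy => ?_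
  simp only [metric_chart_symm X hy.1, paramDensity]

theorem chartVolume_inter_source (X : M → Euc (n + 1)) (e : OpenPartialHomeomorph M (Euc n))
    {s : Set M} (hs : MeasurableSet s) : chartVolume X e (s ∩ e.source) = chartVolume X e s := by
  rw [chartVolume_apply X e hs, chartVolume_apply X e (hs.inter e.open_source.measurableSet)]
  congr 2
  ext y
  simp only [Set.mem_inter_iff, Set.mem_preimage]
  exact ⟨fun h => ⟨h.1, h.2.1⟩, fun h => ⟨h.1, h.2, e.map_target h.1⟩⟩

end Measurable

variable [ChartedSpace (Euc n) M]

theorem gram_change [IsManifold (𝓡 n) ∞ M] {X N : M → Euc (n + 1)} (hX : IsHypersurface X N)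
    (he : e ∈ atlas (Euc n) M) (he' : e' ∈ atlas (Euc n) M) {p : M} (hp : p ∈ e.source)
    (hp' : p ∈ e'.source) :
    Matrix.gram ℝ (coordFrame (X ∘ e.symm) (e p)) =
      jacobian e e' p * Matrix.gram ℝ (coordFrame (X ∘ e'.symm) (e' p)) *
        (jacobian e e' p).transpose := by
  have hd := ((hX.isParam he').contDiffAt (e'.map_source hp')).differentiableAt (by simp)
  ext i j
  simp only [Matrix.gram_apply, coordFrame, coordDeriv_change he he' hp hp' hd, sum_inner, inner_sum,
    real_inner_smul_left, real_inner_smul_right, Matrix.mul_apply, Matrix.transpose_apply,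
    Finset.sum_mul]
  exact Finset.sum_congr rfl fun k _ => Finset.sum_congr rfl fun l _ => by ring

/-- From `g = J g' Jᵀ` one gets `det g = (det J)² det g'`; the root is the factor required by the
change of variables formula. -/
theorem paramDensity_change [IsManifold (𝓡 n) ∞ M] {X N : M → Euc (n + 1)}
    (hX : IsHypersurface X N) (he : e ∈ atlas (Euc n) M) (he' : e' ∈ atlas (Euc n) M) {p : M}
    (hp : p ∈ e.source) (hp' : p ∈ e'.source) :
    paramDensity (X ∘ e.symm) (e p) =
      |(fderiv ℝ (e' ∘ e.symm) (e p)).det| * paramDensity (X ∘ e'.symm) (e' p) := by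
  rw [paramDensity, gram_change hX he he' hp hp', Matrix.det_mul, Matrix.det_mul,
    Matrix.det_transpose, det_fderiv_transition, mul_right_comm, Real.sqrt_mul (mul_self_nonneg _),
    Real.sqrt_mul_self_eq_abs, paramDensity]


theorem aemeasurable_paramDensity [IsManifold (𝓡 n) ∞ M] {X N : M → Euc (n + 1)}
    (hX : IsHypersurface X N) (he : e ∈ atlas (Euc n) M) :
    AEMeasurable (fun y => ENNReal.ofReal (paramDensity (X ∘ e.symm) y))
      (volume.restrict e.target) := by
  have : ContinuousOn (paramDensity (X ∘ e.symm)) e.target := fun y hy =>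
    ((hX.isParam he).contDiffAt_paramDensity hy).continuousAt.continuousWithinAt
  exact (this.aemeasurable e.open_target.measurableSet).ennreal_ofReal

variable [MeasurableSpace M] [BorelSpace M]


variable [IsManifold (𝓡 n) ∞ M] {X N : M → Euc (n + 1)}

/-- The volume measures of two charts agree on the overlap of their domains. -/
theorem chartVolume_congr (hX : IsHypersurface X N) (he : e ∈ atlas (Euc n) M)
    (he' : e' ∈ atlas (Euc n) M) {s : Set M} (hs : MeasurableSet s) (hse : s ⊆ e.source)
    (hse' : s ⊆ e'.source) : chartVolume X e s = chartVolume X e' s := by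
  have himage : e' ∘ e.symm '' (e.target ∩ e.symm ⁻¹' s) = e'.target ∩ e'.symm ⁻¹' s := by
    ext z
    constructor
    · rintro ⟨y, ⟨_, hys⟩, rfl⟩
      exact ⟨e'.map_source (hse' hys), by simpa [e'.left_inv (hse' hys)] using hys⟩
    · rintro ⟨hz, hzs⟩
      exact ⟨e (e'.symm z), ⟨e.map_source (hse hzs), by simpa [e.left_inv (hse hzs)] using hzs⟩,
        by simp [e.left_inv (hse hzs), e'.right_inv hz]⟩
  rw [chartVolume_apply X e hs, chartVolume_apply X e' hs, ← himage,
    lintegral_image_eq_lintegral_abs_det_fderiv_mul volume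
      (measurableSet_target_inter_preimage e hs) (f' := fderiv ℝ (e' ∘ e.symm))]
  · refine setLIntegral_congr_fun (measurableSet_target_inter_preimage e hs) fun y hy => ?_
    have h := paramDensity_change hX he he' (hse hy.2) (hse' hy.2)
    rw [e.right_inv hy.1] at h
    simp only [Function.comp_apply]
    rw [h, ENNReal.ofReal_mul (abs_nonneg _)]
  · intro y hy
    have h := contDiffAt_transition he he' (hse hy.2) (hse' hy.2)
    rw [e.right_inv hy.1] at h
    exact (h.differentiableAt (by simp)).hasFDerivAt.hasFDerivWithinAt
  · intro y hy z hz hyz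
    exact e.symm.injOn hy.1 hz.1 (e'.injOn (hse' hy.2) (hse' hz.2) hyz)

variable [SecondCountableTopology M]

/-- The volume measure restricts to the volume measure of each chart. -/
theorem vol_apply (hX : IsHypersurface X N) (he : e ∈ atlas (Euc n) M) {s : Set M}
    (hs : MeasurableSet s) (hse : s ⊆ e.source) : vol X s = chartVolume X e s := by
  -- One inequality is immediate from the supremum. For the other, `vol X` is bounded by a measure
  -- `μ` glued from countably many charts.
  refine le_antisymm ?_ (Measure.le_iff.1 (le_iSup₂ (f := fun e _ => chartVolume X e) e he) s hs)
  rcases isEmpty_or_nonempty M with hM | hM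
  · simp [Set.eq_empty_of_isEmpty s]
  obtain ⟨c, hc, hcover⟩ := TopologicalSpace.countable_cover_nhds
    (fun p : M => (chartAt (Euc n) p).open_source.mem_nhds (mem_chart_source (Euc n) p))
  have hcne : c.Nonempty := by
    rw [Set.nonempty_iff_ne_empty]
    rintro rfl
    simp [Set.empty_ne_univ] at hcover
  obtain ⟨q, hq⟩ := hc.exists_eq_range hcne
  set D : ℕ → Set M := disjointed fun k => (chartAt (Euc n) (q k)).source with hD
  have hDm : ∀ k, MeasurableSet (D k) :=
    MeasurableSet.disjointed fun k => (chartAt (Euc n) (q k)).open_source.measurableSet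
  have hDU : ⋃ k, D k = Set.univ := by
    rw [hD, iUnion_disjointed, ← hcover, hq, Set.biUnion_range]
  have hDs : ∀ k, D k ⊆ (chartAt (Euc n) (q k)).source := fun k => disjointed_subset _ k
  -- On each piece of a countable disjoint cover, `μ` is the measure of one chart containing the
  -- piece. Since chart measures agree on overlaps, `μ` restricts to every one of them, so it
  -- dominates them all.
  set μ : Measure M := Measure.sum fun k => (chartVolume X (chartAt (Euc n) (q k))).restrict (D k)
    with hμ
  have hμs : ∀ e ∈ atlas (Euc n) M, ∀ t, MeasurableSet t → μ (t ∩ e.source) = chartVolume X e t := by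
    intro e he t ht
    have htm := ht.inter e.open_source.measurableSet
    rw [← chartVolume_inter_source X e ht, hμ, Measure.sum_apply _ htm]
    have h1 : ∀ k, (chartVolume X (chartAt (Euc n) (q k))).restrict (D k) (t ∩ e.source) =
        chartVolume X e (t ∩ e.source ∩ D k) := fun k => by
      rw [Measure.restrict_apply htm]
      exact chartVolume_congr hX (chart_mem_atlas _ _) he (htm.inter (hDm k))
        (Set.inter_subset_right.trans (hDs k)) (fun x hx => hx.1.2)
    simp only [h1]
    rw [← measure_iUnion (fun i j hij => ((disjoint_disjointed _) hij).mono
      Set.inter_subset_right Set.inter_subset_right) (fun k => htm.inter (hDm k)),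
      ← Set.inter_iUnion, hDU, Set.inter_univ]
  have hle : vol X ≤ μ := iSup₂_le fun e he => Measure.le_iff.2 fun t ht => by
    rw [← hμs e he t ht]
    exact measure_mono Set.inter_subset_left
  refine (Measure.le_iff.1 hle s hs).trans ?_
  rw [← hμs e he s hs, Set.inter_eq_left.2 hse]

theorem vol_restrict_source (hX : IsHypersurface X N) (he : e ∈ atlas (Euc n) M) :
    (vol X).restrict e.source = chartVolume X e := by
  ext s hs
  rw [Measure.restrict_apply hs, vol_apply hX he (hs.inter e.open_source.measurableSet)
    Set.inter_subset_right, chartVolume_inter_source X e hs]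

theorem integral_vol_eq (hX : IsHypersurface X N) (he : e ∈ atlas (Euc n) M) {f : M → ℝ}
    (hf : Continuous f) (hfe : Function.support f ⊆ e.source) :
    ∫ p, f p ∂(vol X) = ∫ y in e.target, paramDensity (X ∘ e.symm) y * f (e.symm y) := by
  rw [← setIntegral_eq_integral_of_forall_compl_eq_zero (s := e.source) (fun x hx => by
    by_contra h
    exact hx (hfe h)), vol_restrict_source hX he, chartVolume_eq_map_withDensity,
    integral_map (aemeasurable_chart_symm e _) hf.aestronglyMeasurable,
    integral_withDensity_eq_integral_toReal_smul₀ (aemeasurable_paramDensity hX he)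
      (Filter.Eventually.of_forall fun _ => ENNReal.ofReal_lt_top)]
  refine integral_congr_ae (Filter.Eventually.of_forall fun y => ?_)
  have h := ENNReal.toReal_ofReal (paramDensity_nonneg (X ∘ e.symm) y)
  simp only [smul_eq_mul, h]

theorem integrable_vol (hX : IsHypersurface X N) (he : e ∈ atlas (Euc n) M) {f : M → ℝ}
    (hf : Continuous f) (hfc : HasCompactSupport f) (hfe : tsupport f ⊆ e.source) :
    Integrable f (vol X) := by
  rw [← integrableOn_iff_integrable_of_support_subset ((subset_tsupport f).trans hfe), IntegrableOn,
    vol_restrict_source hX he, chartVolume_eq_map_withDensity,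
    integrable_map_measure hf.aestronglyMeasurable (aemeasurable_chart_symm e _),
    integrable_withDensity_iff_integrable_smul₀' (aemeasurable_paramDensity hX he)
      (Filter.Eventually.of_forall fun _ => ENNReal.ofReal_lt_top)]
  have hK : IsCompact (e '' tsupport f) := hfc.isCompact.image_of_continuousOn
    (e.continuousOn.mono hfe)
  have hKt : e '' tsupport f ⊆ e.target := by
    rintro _ ⟨p, hp, rfl⟩
    exact e.map_source (hfe hp)
  have hc : ContinuousOn (fun y => (ENNReal.ofReal (paramDensity (X ∘ e.symm) y)).toReal •
      (f ∘ e.symm) y) e.target := by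
    have h1 : ContinuousOn (paramDensity (X ∘ e.symm)) e.target := fun y hy =>
      ((hX.isParam he).contDiffAt_paramDensity hy).continuousAt.continuousWithinAt
    have h2 : ∀ y, (ENNReal.ofReal (paramDensity (X ∘ e.symm) y)).toReal =
        paramDensity (X ∘ e.symm) y := fun y => ENNReal.toReal_ofReal (paramDensity_nonneg _ y)
    simp only [h2]
    exact h1.smul (hf.comp_continuousOn e.continuousOn_symm)
  -- Off the compact image of the support the integrand vanishes, so continuity on that image is
  -- enough.
  refine IntegrableOn.of_forall_sdiff_eq_zero ((hc.mono hKt).integrableOn_compact hK)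
    e.open_target.measurableSet fun y hy => ?_
  have : f (e.symm y) = 0 := by
    by_contra h
    exact hy.2 ⟨e.symm y, subset_tsupport f h, e.right_inv hy.1⟩
  simp [this]

end Volume

/-! ### Integration by parts -/

section Integration

/-- Integration by parts over an open set, against a function with compact support in it. -/
theorem integral_mul_coordDeriv_add_eq_zero {n : ℕ} {U : Set (Euc n)} (hU : IsOpen U)
    {f Q : Euc n → ℝ} (hf : ContDiff ℝ 1 f) (hfc : HasCompactSupport f) (hfU : tsupport f ⊆ U)
    (hQ : ContDiffOn ℝ 1 Q U) (k : Fin n) :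
    IntegrableOn (fun y => f y * coordDeriv k Q y + coordDeriv k f y * Q y) U ∧
      ∫ y in U, (f y * coordDeriv k Q y + coordDeriv k f y * Q y) = 0 := by
  have hQat : ∀ y ∈ U, ContDiffAt ℝ 1 Q y := fun y hy => hQ.contDiffAt (hU.mem_nhds hy)
  have hQ' : ContinuousOn (coordDeriv k Q) U := fun y hy =>
    (contDiffAt_coordDeriv (m := 0) (hQat y hy) (by simp) k).continuousAt.continuousWithinAt
  have hf' : Continuous (coordDeriv k f) := continuous_iff_continuousAt.2 fun y =>
    (contDiffAt_coordDeriv (m := 0) hf.contDiffAt (by simp) k).continuousAt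
  have hsupp : Function.support (coordDeriv k f) ⊆ tsupport f := fun y hy =>
    support_fderiv_subset ℝ fun h => hy (by rw [coordDeriv, h]; rfl)
  have hint : ∀ g q : Euc n → ℝ, Continuous g → Function.support g ⊆ tsupport f →
      ContinuousOn q U → Integrable fun y => g y * q y := by
    intro g q hg hgs hq
    have hgt : tsupport g ⊆ tsupport f := closure_minimal hgs (isClosed_tsupport f)
    have hmt : tsupport (fun y => g y * q y) ⊆ tsupport g := tsupport_mul_subset_left
    -- Nothing is known of `q` outside `U`, but the closed support of `g` lies in `U`, so the
    -- product is continuous everywhere.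
    have hc : Continuous fun y => g y * q y :=
      (hg.continuousOn.mul hq).continuous_of_tsupport_subset hU (hmt.trans (hgt.trans hfU))
    exact hc.integrable_of_hasCompactSupport
      (hfc.of_isClosed_subset (isClosed_tsupport _) (hmt.trans hgt))
  have i1 := hint f _ hf.continuous (subset_tsupport f) hQ'
  have i2 := hint _ Q hf' hsupp hQ.continuousOn
  have i3 := hint f Q hf.continuous (subset_tsupport f) hQ.continuousOn
  refine ⟨(i1.add i2).integrableOn, ?_⟩
  rw [setIntegral_eq_integral_of_forall_compl_eq_zero, integral_add i1 i2]
  · have h := integral_mul_fderiv_eq_neg_fderiv_mul_of_integrable (μ := volume)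
      (v := EuclideanSpace.single k (1 : ℝ)) i2 i1 i3
      (fun x _ => (hf.differentiable (by simp)) x)
      (fun x hx => (hQat x (hfU hx)).differentiableAt (by simp))
    have h' : ∫ y, f y * coordDeriv k Q y = -∫ y, coordDeriv k f y * Q y := h
    rw [h', neg_add_cancel]
  · intro y hy
    have h1 : f y = 0 := by
      by_contra h
      exact hy (hfU (subset_tsupport f h))
    have h2 : coordDeriv k f y = 0 := by
      by_contra h
      exact hy (hfU (hsupp h))
    rw [h1, h2, zero_mul, zero_mul, add_zero]

variable {n : ℕ} {M : Type*} [TopologicalSpace M] [ChartedSpace (Euc n) M]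

/-- Locality of the gradient; it confines the integrand of the integration by parts to the support
of `u₁`. -/
theorem grad_eq_zero_of_notMem_tsupport (X : M → Euc (n + 1)) {u : M → ℝ} {p : M}
    (hp : p ∉ tsupport u) : grad X u p = 0 := by
  have hu : u =ᶠ[nhds p] 0 := notMem_tsupport_iff_eventuallyEq.1 hp
  have hs := mem_chart_source (Euc n) p
  have hz : u ∘ (chartAt (Euc n) p).symm =ᶠ[nhds (chartAt (Euc n) p p)] fun _ => 0 := by
    have hcont := (chartAt (Euc n) p).continuousAt_symm ((chartAt (Euc n) p).map_source hs)
    rw [ContinuousAt, (chartAt (Euc n) p).left_inv hs] at hcont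
    exact hcont.eventually hu
  rw [grad_eq_paramGrad_chartAt, paramGrad]
  refine Finset.sum_eq_zero fun i _ => ?_
  rw [coordDeriv_congr hz, coordDeriv_const, zero_smul]

/-- The sum of the two integrands in the integration by parts formula for `L`. -/
def byPartsIntegrand (X N : M → Euc (n + 1)) (u₁ u₂ : M → ℝ) (p : M) : ℝ :=
  u₁ p * opL X N u₂ p * gaussWeight X p +
    (inner ℝ (grad X u₁ p) (grad X u₂ p) - normSqA X N p * u₁ p * u₂ p - (1 / 2) * u₁ p * u₂ p) *
      gaussWeight X p

theorem support_byPartsIntegrand_subset (X N : M → Euc (n + 1)) (u₁ u₂ : M → ℝ) :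
    Function.support (byPartsIntegrand X N u₁ u₂) ⊆ tsupport u₁ := by
  intro p hp
  by_contra h
  refine hp ?_
  simp [byPartsIntegrand, grad_eq_zero_of_notMem_tsupport X h, image_eq_zero_of_notMem_tsupport h]

variable [IsManifold (𝓡 n) ∞ M] {X N : M → Euc (n + 1)}

theorem grad_sum (X : M → Euc (n + 1)) {ι : Type*} (s : Finset ι) {f : ι → M → ℝ}
    (hf : ∀ i, ContMDiff (𝓡 n) 𝓘(ℝ, ℝ) 1 (f i)) (p : M) :
    grad X (fun q => ∑ i ∈ s, f i q) p = ∑ i ∈ s, grad X (f i) p := by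
  simp only [grad_eq_paramGrad_chartAt, paramGrad]
  rw [Finset.sum_comm]
  refine Finset.sum_congr rfl fun k _ => ?_
  rw [← Finset.sum_smul]
  congr 1
  have hd : ∀ i, DifferentiableAt ℝ (f i ∘ (chartAt (Euc n) p).symm) (chartAt (Euc n) p p) :=
    fun i => (contDiffAt_comp_chart_symm (by simp) (hf i) (chart_mem_atlas _ p)
      ((chartAt (Euc n) p).map_source (mem_chart_source _ p))).differentiableAt (by simp)
  have h : coordDeriv k (fun z => ∑ i : s, (f i ∘ (chartAt (Euc n) p).symm) z)
      (chartAt (Euc n) p p) = _ := coordDeriv_sum (fun i : s => hd i) k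
  rw [← Finset.sum_coe_sort s
    (fun i => coordDeriv k (f i ∘ (chartAt (Euc n) p).symm) (chartAt (Euc n) p p)), ← h]
  congr 1
  funext z
  exact (Finset.sum_coe_sort s fun i => f i ((chartAt (Euc n) p).symm z)).symm

theorem continuous_mul_opL (hX : IsHypersurface X N) {u₁ u₂ : M → ℝ}
    (hu₁ : ContMDiff (𝓡 n) 𝓘(ℝ, ℝ) 1 u₁) (hu₂ : ContMDiff (𝓡 n) 𝓘(ℝ, ℝ) 2 u₂) :
    Continuous fun p => u₁ p * opL X N u₂ p * gaussWeight X p :=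
  (hu₁.continuous.mul (continuous_opL hX hu₂)).mul (continuous_gaussWeight hX)

theorem continuous_dirichlet (hX : IsHypersurface X N) {u₁ u₂ : M → ℝ}
    (hu₁ : ContMDiff (𝓡 n) 𝓘(ℝ, ℝ) 1 u₁) (hu₂ : ContMDiff (𝓡 n) 𝓘(ℝ, ℝ) 2 u₂) :
    Continuous fun p => (inner ℝ (grad X u₁ p) (grad X u₂ p) - normSqA X N p * u₁ p * u₂ p -
      (1 / 2) * u₁ p * u₂ p) * gaussWeight X p := by
  have h1 := hu₁.continuous
  have h2 := hu₂.continuous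
  exact (((continuous_inner_grad hX hu₁ (hu₂.of_le (by norm_num))).sub
    (((continuous_normSqA hX).mul h1).mul h2)).sub
    ((continuous_const.mul h1).mul h2)).mul (continuous_gaussWeight hX)

theorem continuous_byPartsIntegrand (hX : IsHypersurface X N) {u₁ u₂ : M → ℝ}
    (hu₁ : ContMDiff (𝓡 n) 𝓘(ℝ, ℝ) 1 u₁) (hu₂ : ContMDiff (𝓡 n) 𝓘(ℝ, ℝ) 2 u₂) :
    Continuous (byPartsIntegrand X N u₁ u₂) :=
  (continuous_mul_opL hX hu₁ hu₂).add (continuous_dirichlet hX hu₁ hu₂)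

theorem byPartsIntegrand_sum (X N : M → Euc (n + 1)) {ι : Type*} (s : Finset ι) {f : ι → M → ℝ}
    (hf : ∀ i, ContMDiff (𝓡 n) 𝓘(ℝ, ℝ) 1 (f i)) (u : M → ℝ) (p : M) :
    byPartsIntegrand X N (fun q => ∑ i ∈ s, f i q) u p =
      ∑ i ∈ s, byPartsIntegrand X N (f i) u p := by
  simp only [byPartsIntegrand, grad_sum X s hf, sum_inner, Finset.sum_mul, Finset.mul_sum,
    ← Finset.sum_sub_distrib, ← Finset.sum_add_distrib]

/-- The `|A|²` and `1 / 2` terms cancel, and the weighted divergence formula for `∇u₂` leaves `∑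
∂ₖ(u₁ Qᵏ)`, expanded by the product rule, with `Qᵏ = ⟨∇u₂, θᵏ⟩ √(det g) e^{-|x|²/4}`. -/
theorem byPartsIntegrand_chart (hX : IsHypersurface X N)
    {e : OpenPartialHomeomorph M (Euc n)} (he : e ∈ atlas (Euc n) M) {u₁ u₂ : M → ℝ}
    (hu₁ : ContMDiff (𝓡 n) 𝓘(ℝ, ℝ) 1 u₁) (hu₂ : ContMDiff (𝓡 n) 𝓘(ℝ, ℝ) 2 u₂) {y : Euc n}
    (hy : y ∈ e.target) :
    paramDensity (X ∘ e.symm) y * byPartsIntegrand X N u₁ u₂ (e.symm y) =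
      ∑ k, ((u₁ ∘ e.symm) y * coordDeriv k (fun z =>
          inner ℝ (paramGrad (X ∘ e.symm) (u₂ ∘ e.symm) z) (coordDualFrame (X ∘ e.symm) k z) *
            (paramDensity (X ∘ e.symm) z * Real.exp (-‖(X ∘ e.symm) z‖ ^ 2 / 4))) y +
        coordDeriv k (u₁ ∘ e.symm) y *
          (inner ℝ (paramGrad (X ∘ e.symm) (u₂ ∘ e.symm) y) (coordDualFrame (X ∘ e.symm) k y) *
            (paramDensity (X ∘ e.symm) y * Real.exp (-‖(X ∘ e.symm) y‖ ^ 2 / 4)))) := by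
  have h := hX.isParam he
  have hGd : DifferentiableAt ℝ (paramGrad (X ∘ e.symm) (u₂ ∘ e.symm)) y :=
    (h.contDiffAt_paramGrad hy (m := 1) (by simp) (by
      rw [one_add_one_eq_two]
      exact contDiffAt_comp_chart_symm ENat.LEInfty.out hu₂ he hy)).differentiableAt (by simp)
  have hp := e.map_target hy
  rw [Finset.sum_add_distrib, ← Finset.mul_sum,
    h.sum_coordDeriv_eq_paramDiv hy hGd (h.inner_paramGrad_normal hy _)]
  simp only [← mul_assoc, ← Finset.sum_mul]
  rw [← inner_paramGrad, byPartsIntegrand, opL_eq_paramL hX he hu₂ hp,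
    normSqA_eq_paramNormSqA hX he hp, grad_eq_paramGrad hX he hu₁ hp,
    grad_eq_paramGrad hX he (hu₂.of_le (by norm_num)) hp, e.right_inv hy, paramL, gaussWeight]
  simp only [Function.comp_apply]
  ring

variable [MeasurableSpace M] [BorelSpace M] [SecondCountableTopology M] [CompactSpace M]

theorem integral_byPartsIntegrand_of_tsupport_subset (hX : IsHypersurface X N)
    {e : OpenPartialHomeomorph M (Euc n)} (he : e ∈ atlas (Euc n) M) {u₁ u₂ : M → ℝ}
    (hu₁ : ContMDiff (𝓡 n) 𝓘(ℝ, ℝ) 1 u₁) (hu₂ : ContMDiff (𝓡 n) 𝓘(ℝ, ℝ) 2 u₂)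
    (hsupp : tsupport u₁ ⊆ e.source) :
    ∫ p, byPartsIntegrand X N u₁ u₂ p ∂(vol X) = 0 := by
  have h := hX.isParam he
  rw [integral_vol_eq hX he (continuous_byPartsIntegrand hX hu₁ hu₂)
    ((support_byPartsIntegrand_subset X N u₁ u₂).trans hsupp),
    setIntegral_congr_fun e.open_target.measurableSet
      (fun y hy => byPartsIntegrand_chart hX he hu₁ hu₂ hy)]
  -- Outside `e.target` the values of `e.symm` are meaningless, so the function is extended by zero
  -- there.
  set f : Euc n → ℝ := e.target.indicator (u₁ ∘ e.symm) with hf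
  have hfeq : Set.EqOn f (u₁ ∘ e.symm) e.target := fun y hy => Set.indicator_of_mem hy _
  have hK : IsCompact (e '' tsupport u₁) :=
    (isClosed_tsupport u₁).isCompact.image_of_continuousOn (e.continuousOn.mono hsupp)
  have hKt : e '' tsupport u₁ ⊆ e.target := by
    rintro _ ⟨p, hp, rfl⟩
    exact e.map_source (hsupp hp)
  have hfK : Function.support f ⊆ e '' tsupport u₁ := fun y hy => by
    have hyt : y ∈ e.target := by
      by_contra h
      exact hy (Set.indicator_of_notMem h _)
    have hne : u₁ (e.symm y) ≠ 0 := by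
      rw [Function.mem_support, hfeq hyt] at hy
      exact hy
    exact ⟨e.symm y, subset_tsupport _ hne, e.right_inv hyt⟩
  have hftK : tsupport f ⊆ e '' tsupport u₁ := closure_minimal hfK hK.isClosed
  have hfc : HasCompactSupport f := hK.of_isClosed_subset (isClosed_tsupport f) hftK
  -- Near its support `f` coincides with `u₁ ∘ e.symm`; elsewhere it is locally zero.
  have hfd : ContDiff ℝ 1 f := contMDiff_iff_contDiff.1 <| contMDiff_of_tsupport fun y hy =>
    ((contDiffAt_comp_chart_symm (by simp) hu₁ he (hKt (hftK hy))).congr_of_eventuallyEq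
      (Filter.eventuallyEq_of_mem (e.open_target.mem_nhds (hKt (hftK hy))) hfeq)).contMDiffAt
  have hQ : ∀ k, ContDiffOn ℝ 1 (fun z =>
      inner ℝ (paramGrad (X ∘ e.symm) (u₂ ∘ e.symm) z) (coordDualFrame (X ∘ e.symm) k z) *
        (paramDensity (X ∘ e.symm) z * Real.exp (-‖(X ∘ e.symm) z‖ ^ 2 / 4))) e.target :=
    fun k y hy => by
      have h1 : ContDiffAt ℝ 1 (paramGrad (X ∘ e.symm) (u₂ ∘ e.symm)) y :=
        h.contDiffAt_paramGrad hy (by simp) (by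
          rw [one_add_one_eq_two]
          exact contDiffAt_comp_chart_symm ENat.LEInfty.out hu₂ he hy)
      have h2 := (h.contDiffAt_coordDualFrame hy k).of_le (m := 1) (by simp)
      have h3 := (h.contDiffAt_paramDensity hy).of_le (m := 1) (by simp)
      have h4 := ((h.contDiffAt hy).of_le (m := 1) (by simp)).norm_sq ℝ
      exact ((h1.inner ℝ h2).mul (h3.mul (h4.neg.div_const 4).exp)).contDiffWithinAt
  have hparts := fun k =>
    integral_mul_coordDeriv_add_eq_zero e.open_target hfd hfc (hftK.trans hKt) (hQ k) k
  rw [setIntegral_congr_fun e.open_target.measurableSet (g := fun y => ∑ k, (f y * coordDeriv k (fun z =>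
      inner ℝ (paramGrad (X ∘ e.symm) (u₂ ∘ e.symm) z) (coordDualFrame (X ∘ e.symm) k z) *
        (paramDensity (X ∘ e.symm) z * Real.exp (-‖(X ∘ e.symm) z‖ ^ 2 / 4))) y +
      coordDeriv k f y *
        (inner ℝ (paramGrad (X ∘ e.symm) (u₂ ∘ e.symm) y) (coordDualFrame (X ∘ e.symm) k y) *
          (paramDensity (X ∘ e.symm) y * Real.exp (-‖(X ∘ e.symm) y‖ ^ 2 / 4))))),
    integral_finsetSum _ fun k _ => (hparts k).1]
  · exact Finset.sum_eq_zero fun k _ => (hparts k).2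
  · intro y hy
    have hfd : ∀ k, coordDeriv k f y = coordDeriv k (u₁ ∘ e.symm) y :=
      coordDeriv_congr (Filter.eventuallyEq_of_mem (e.open_target.mem_nhds hy) hfeq)
    simp only [hfd, hfeq hy]

/-- On a compact manifold, there is a finite smooth partition of unity
subordinate to domains of charts. -/
theorem exists_finite_partition (n : ℕ) (M : Type*) [TopologicalSpace M] [ChartedSpace (Euc n) M]
    [IsManifold (𝓡 n) ∞ M] [T2Space M] [CompactSpace M] :
    ∃ (s : Finset M) (ρ : M → M → ℝ), (∀ i, ContMDiff (𝓡 n) 𝓘(ℝ, ℝ) ∞ (ρ i)) ∧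
      (∀ i, tsupport (ρ i) ⊆ (chartAt (Euc n) i).source) ∧ ∀ p, ∑ i ∈ s, ρ i p = 1 := by
  obtain ⟨ρ, hρ⟩ := SmoothPartitionOfUnity.exists_isSubordinate_chartAt_source (𝓡 n) M
  have hfin := ρ.locallyFinite.finite_nonempty_of_compact
  refine ⟨hfin.toFinset, fun i => ρ i, fun i => (ρ i).contMDiff, hρ, fun p => ?_⟩
  rw [← ρ.sum_eq_one (Set.mem_univ p)]
  refine (finsum_eq_sum_of_support_subset _ fun i hi => ?_).symm
  simp only [Set.Finite.coe_toFinset, Set.mem_ofPred_eq]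
  exact ⟨p, hi⟩

variable [T2Space M]

/-- A continuous function on a compact hypersurface is integrable. -/
theorem integrable_vol_of_continuous (hX : IsHypersurface X N) {g : M → ℝ} (hg : Continuous g) :
    Integrable g (vol X) := by
  obtain ⟨s, ρ, hρ, hρs, hsum⟩ := exists_finite_partition n M
  have heq : g = fun p => ∑ i ∈ s, ρ i p * g p := by
    funext p
    rw [← Finset.sum_mul, hsum, one_mul]
  rw [heq]
  refine integrable_finsetSum _ fun i _ => ?_
  exact integrable_vol hX (chart_mem_atlas (Euc n) i) ((hρ i).continuous.mul hg)
    (HasCompactSupport.of_compactSpace _) (tsupport_mul_subset_left.trans (hρs i))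

/-- The integrand is additive in `u₁`, so cutting `u₁` alone by the partition of unity reduces to
functions supported in a chart; `u₂` stays global. -/
theorem integral_byPartsIntegrand (hX : IsHypersurface X N) {u₁ u₂ : M → ℝ}
    (hu₁ : ContMDiff (𝓡 n) 𝓘(ℝ, ℝ) 1 u₁) (hu₂ : ContMDiff (𝓡 n) 𝓘(ℝ, ℝ) 2 u₂) :
    ∫ p, byPartsIntegrand X N u₁ u₂ p ∂(vol X) = 0 := by
  obtain ⟨s, ρ, hρ, hρs, hsum⟩ := exists_finite_partition n M
  have hd : ∀ i, ContMDiff (𝓡 n) 𝓘(ℝ, ℝ) 1 (fun p => ρ i p * u₁ p) := fun i =>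
    ((hρ i).of_le (by simp)).mul hu₁
  have heq : u₁ = fun p => ∑ i ∈ s, ρ i p * u₁ p := by
    funext p
    rw [← Finset.sum_mul, hsum, one_mul]
  rw [heq]
  simp only [byPartsIntegrand_sum X N s hd]
  rw [integral_finsetSum _ fun i _ =>
    integrable_vol_of_continuous hX (continuous_byPartsIntegrand hX (hd i) hu₂)]
  exact Finset.sum_eq_zero fun i _ => integral_byPartsIntegrand_of_tsupport_subset hX
    (chart_mem_atlas (Euc n) i) (hd i) hu₂ (tsupport_mul_subset_left.trans (hρs i))

theorem neg_integral_mul_opL (hX : IsHypersurface X N) {u₁ u₂ : M → ℝ}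
    (hu₁ : ContMDiff (𝓡 n) 𝓘(ℝ, ℝ) 1 u₁) (hu₂ : ContMDiff (𝓡 n) 𝓘(ℝ, ℝ) 2 u₂) :
    -∫ p, u₁ p * opL X N u₂ p * gaussWeight X p ∂(vol X) =
      ∫ p, (inner ℝ (grad X u₁ p) (grad X u₂ p) - normSqA X N p * u₁ p * u₂ p -
        (1 / 2) * u₁ p * u₂ p) * gaussWeight X p ∂(vol X) := by
  have h := integral_byPartsIntegrand hX hu₁ hu₂
  unfold byPartsIntegrand at h
  rw [integral_add (integrable_vol_of_continuous hX (continuous_mul_opL hX hu₁ hu₂))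
    (integrable_vol_of_continuous hX (continuous_dirichlet hX hu₁ hu₂))] at h
  linarith

/-- Both sides equal minus the same Dirichlet-type form, which is symmetric in `u₁` and `u₂`. -/
theorem integral_mul_opL_comm (hX : IsHypersurface X N) {u₁ u₂ : M → ℝ}
    (hu₁ : ContMDiff (𝓡 n) 𝓘(ℝ, ℝ) 2 u₁) (hu₂ : ContMDiff (𝓡 n) 𝓘(ℝ, ℝ) 2 u₂) :
    ∫ p, u₁ p * opL X N u₂ p * gaussWeight X p ∂(vol X) =
      ∫ p, opL X N u₁ p * u₂ p * gaussWeight X p ∂(vol X) := by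
  have h1 := neg_integral_mul_opL hX (hu₁.of_le (by norm_num)) hu₂
  have h2 := neg_integral_mul_opL hX (hu₂.of_le (by norm_num)) hu₁
  have h3 : ∀ p, (inner ℝ (grad X u₂ p) (grad X u₁ p) - normSqA X N p * u₂ p * u₁ p -
      (1 / 2) * u₂ p * u₁ p) * gaussWeight X p =
      (inner ℝ (grad X u₁ p) (grad X u₂ p) - normSqA X N p * u₁ p * u₂ p -
        (1 / 2) * u₁ p * u₂ p) * gaussWeight X p := fun p => by
    rw [real_inner_comm]
    ring
  simp only [h3, ← h1, mul_comm (u₂ _)] at h2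
  linarith

end Integration

end Hypersurface

end

theorem theoremt {n : ℕ} {M : Type*} [TopologicalSpace M] [T2Space M] [SecondCountableTopology M]
    [ChartedSpace (Euc n) M] [IsManifold (𝓡 n) ∞ M] [MeasurableSpace M] [BorelSpace M]
    (X N : M → Euc (n + 1)) (hX : Hypersurface.IsHypersurface X N)
    (hS : Hypersurface.IsSelfShrinker X N) :
    -- the mean curvature satisfies `L H = H`
    (ContMDiff (𝓡 n) 𝓘(ℝ, ℝ) ∞ (Hypersurface.meanCurvature X N) ∧
      (∀ p, Hypersurface.opL X N (Hypersurface.meanCurvature X N) p =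
        Hypersurface.meanCurvature X N p) ∧
      ((∃ p, Hypersurface.meanCurvature X N p ≠ 0) →
        Hypersurface.IsEigenfunction (n := n) (Hypersurface.opL X N) (-1)
          (Hypersurface.meanCurvature X N))) ∧
    -- the normal part of a constant vector satisfies `L ⟨v, n⟩ = ⟨v, n⟩ / 2`
    (∀ v : Euc (n + 1),
      ContMDiff (𝓡 n) 𝓘(ℝ, ℝ) ∞ (fun q => inner ℝ v (N q)) ∧
      (∀ p, Hypersurface.opL X N (fun q => inner ℝ v (N q)) p = (1 / 2) * inner ℝ v (N p)) ∧
      ((∃ p, inner ℝ v (N p) ≠ 0) →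
        Hypersurface.IsEigenfunction (n := n) (Hypersurface.opL X N) (-(1 / 2))
          (fun q => inner ℝ v (N q)))) ∧
    -- in the compact case, `L` is self-adjoint in the weighted space
    (CompactSpace M →
      (∀ u₁ u₂ : M → ℝ, ContMDiff (𝓡 n) 𝓘(ℝ, ℝ) 2 u₁ → ContMDiff (𝓡 n) 𝓘(ℝ, ℝ) 2 u₂ →
        ∫ p, u₁ p * Hypersurface.opL X N u₂ p * Hypersurface.gaussWeight X p
            ∂(Hypersurface.vol X) =
          ∫ p, Hypersurface.opL X N u₁ p * u₂ p * Hypersurface.gaussWeight X p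
            ∂(Hypersurface.vol X)) ∧
      (∀ u₁ u₂ : M → ℝ, ContMDiff (𝓡 n) 𝓘(ℝ, ℝ) 1 u₁ → ContMDiff (𝓡 n) 𝓘(ℝ, ℝ) 2 u₂ →
        Integrable (fun p => u₁ p * Hypersurface.opL X N u₂ p * Hypersurface.gaussWeight X p)
          (Hypersurface.vol X) ∧
        Integrable (fun p =>
            (inner ℝ (Hypersurface.grad X u₁ p) (Hypersurface.grad X u₂ p) -
              Hypersurface.normSqA X N p * u₁ p * u₂ p - (1 / 2) * u₁ p * u₂ p) *
              Hypersurface.gaussWeight X p)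
          (Hypersurface.vol X) ∧
        -∫ p, u₁ p * Hypersurface.opL X N u₂ p * Hypersurface.gaussWeight X p
            ∂(Hypersurface.vol X) =
          ∫ p, (inner ℝ (Hypersurface.grad X u₁ p) (Hypersurface.grad X u₂ p) -
              Hypersurface.normSqA X N p * u₁ p * u₂ p - (1 / 2) * u₁ p * u₂ p) *
              Hypersurface.gaussWeight X p ∂(Hypersurface.vol X))) := by
  refine ⟨⟨Hypersurface.contMDiff_meanCurvature hX hS, Hypersurface.opL_meanCurvature hX hS,
    fun hne => ⟨Hypersurface.contMDiff_meanCurvature hX hS, fun p => ?_, hne⟩⟩,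
    fun v => ⟨Hypersurface.contMDiff_inner_normal hX v, Hypersurface.opL_inner_normal hX hS v,
      fun hne => ⟨Hypersurface.contMDiff_inner_normal hX v, fun p => ?_, hne⟩⟩,
    fun _ => ⟨fun u₁ u₂ hu₁ hu₂ => Hypersurface.integral_mul_opL_comm hX hu₁ hu₂,
      fun u₁ u₂ hu₁ hu₂ => ⟨?_, ?_, Hypersurface.neg_integral_mul_opL hX hu₁ hu₂⟩⟩⟩
  · rw [Hypersurface.opL_meanCurvature hX hS, neg_neg, one_mul]
  · rw [Hypersurface.opL_inner_normal hX hS, neg_neg]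
  · exact Hypersurface.integrable_vol_of_continuous hX
      (Hypersurface.continuous_mul_opL hX hu₁ hu₂)
  · exact Hypersurface.integrable_vol_of_continuous hX
      (Hypersurface.continuous_dirichlet hX hu₁ hu₂)
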